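/- Let $L^2=L^2(0,\pi/2)$ be the real Hilbert space with norm $\|\zeta\|=\big(\int_0^{\pi/2}|\zeta(\sigma)|^2\,d\sigma\big)^{1/2}$. For $\zeta\in L^2$ put $$(H\zeta)(\sigma)=\frac1\pi\int_0^{\pi/2}\log\Big|\frac{\sin(s+\sigma)}{\sin(s-\sigma)}\Big|\,\zeta(s)\,ds,$$ and, for a real number $\alpha>0$, $$\Phi(\zeta)(\sigma)=\frac{3}{\alpha\pi}\,\frac{\sin\big(\sigma+\frac13(H\zeta)(\sigma)\big)\cot\sigma}{\exp\int_0^\sigma\zeta(s)\,ds},\qquad \sigma\in(0,\pi/2).$$ **Theorem.** For every $\alpha\ge\frac2\pi\big(1+\frac1{3\sqrt\pi}\big)\approx 0.76$ there exists a function $\zeta\in L^2$, non-negative almost everywhere, such that $\zeta=\Phi(\zeta)$ almost everywhere on $(0,\pi/2)$, $$0\le\sigma+\tfrac13(H\zeta)(\sigma)\le\pi\quad\text{for almost all }\sigma\in(0,\pi/2),\qquad\text{and}\qquad \|\zeta\|\le\frac{9\sqrt\pi}{2}.$$ -/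

import Mathlib

open MeasureTheory Set

noncomputable section

namespace Nekrasov

/-- The real Hilbert space `L²(0, π/2)` with its standard norm. -/
abbrev L2 : Type := Lp ℝ 2 (volume.restrict (Ioo (0 : ℝ) (Real.pi / 2)))

/-- The kernel `K(s, σ) = log |sin (s + σ) / sin (s - σ)|`. -/
def K (s σ : ℝ) : ℝ := Real.log |Real.sin (s + σ) / Real.sin (s - σ)|

/-- The integral operator `(H ζ)(σ) = (1/π) ∫₀^{π/2} K(s, σ) ζ(s) ds`. For `ζ ∈ L²(0, π/2)` the
integrand is integrable for every `σ`, since `K(·, σ)` is square-integrable. -/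
def H (ζ : ℝ → ℝ) (σ : ℝ) : ℝ :=
  (1 / Real.pi) * ∫ s in (0 : ℝ)..(Real.pi / 2), K s σ * ζ s

/-- The nonlinear operator
`Φ(ζ)(σ) = (3 / (α π)) · sin (σ + (H ζ)(σ) / 3) · cot σ / exp (∫₀^σ ζ ds)`. -/
def Phi (α : ℝ) (ζ : ℝ → ℝ) (σ : ℝ) : ℝ :=
  3 / (α * Real.pi) *
    (Real.sin (σ + 1 / 3 * H ζ σ) * Real.cot σ / Real.exp (∫ s in (0 : ℝ)..σ, ζ s))

end Nekrasov

end

/-! On the convex set of non-negative ζ with ‖ζ‖ ≤ R = 9√π/2, Φ is a self-map that is continuous for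
weak convergence when tested against indicators. A Galerkin scheme then produces a fixed point.

Invariance. Expanding K(s,σ) as Σ (2/n) sin 2ns sin 2nσ gives ‖K(·,σ)‖² ≤ πσ(π−2σ), hence |Hζ(σ)| ≤
√(σ(π−2σ)/π)‖ζ‖ (`abs_H_le`). For ‖ζ‖ ≤ R this keeps the angle σ + Hζ/3 in [0,π] (`angle_mem_Icc`),
so Φ(ζ) ≥ 0. With sin x ≤ x and exp ≥ 1, Φ(ζ) ≤ (3σ cot σ + cot σ · Hζ)/(απ). Since ‖σ cot σ‖ ≤ 1
and ‖cot · Hζ‖ ≤ 2‖ζ‖ (the Hardy inequality `lintegral_enorm_cot_mul_H_sq_le`), the norm of Φ(ζ) is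
at most (3+2R)/(απ). The bound on α says exactly that this is at most R.

Existence. Hζ(σ) and ∫₀^σ ζ are inner products of ζ with fixed L² functions, so weak convergence
gives pointwise convergence of Φ. A majorant Cσ^(−1/2) turns this into convergence of integrals
(`tendsto_setIntegral_Phi`). On step functions over a uniform grid, Brouwer's theorem gives z in the
set with the same cell integrals as Φ(z). A weak limit ζ of such z has the same primitive as Φ(ζ),
which forces equality almost everywhere. Brouwer's theorem is proved by change of variables and
polynomial extrapolation. -/

/-! ### Brouwer's fixed point theorem -/

section Brouwer

open Metric Filter Topology Polynomial

variable {E : Type*} [NormedAddCommGroup E] [InnerProductSpace ℝ E] [FiniteDimensional ℝ E]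

/-- A small multiple of a Lipschitz map is a bijective perturbation of the identity. -/
theorem bijective_id_add_smul_of_lipschitz {h : E → E} {L : NNReal} (hL : LipschitzWith L h) {t : ℝ}
    (ht : |t| * L < 1) : Function.Bijective fun x => x + t • h x := by
  have hc : ∀ y : E, ContractingWith (‖t‖₊ * L) fun x => y - t • h x := by
    intro y
    refine ⟨by rw [← NNReal.coe_lt_coe]; simpa using ht, ?_⟩
    refine LipschitzWith.of_dist_le_mul fun a b => ?_
    have h1 := hL.dist_le_mul a b
    rw [dist_eq_norm] at h1 ⊢
    have : y - t • h a - (y - t • h b) = -(t • (h a - h b)) := by rw [smul_sub]; abel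
    rw [this, norm_neg, norm_smul]
    push_cast
    rw [mul_assoc]
    gcongr
  constructor
  · intro a b hab
    have hab' : a + t • h a = b + t • h b := hab
    refine (hc (a + t • h a)).fixedPoint_unique' (x := a) (y := b) ?_ ?_
    · simp [Function.IsFixedPt]
    · simp [Function.IsFixedPt, hab']
  · intro y
    refine ⟨ContractingWith.fixedPoint _ (hc y), ?_⟩
    have := (hc y).fixedPoint_isFixedPt
    have h2 : y - t • h (ContractingWith.fixedPoint _ (hc y)) = ContractingWith.fixedPoint _ (hc y) := this
    exact (sub_eq_iff_eq_add.1 h2).symm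

omit [InnerProductSpace ℝ E] [FiniteDimensional ℝ E] in
theorem image_closedBall_eq_of_bijective {f : E → E} {R : ℝ} (hf : Function.Bijective f)
    (hid : ∀ x, R < ‖x‖ → f x = x) : f '' closedBall 0 R = closedBall 0 R := by
  ext y
  simp only [mem_image, mem_closedBall, dist_zero_right]
  constructor
  · rintro ⟨x, hx, rfl⟩
    by_contra! hy
    have : f x = x := hf.1 (hid _ hy)
    rw [this] at hy
    exact absurd hx (not_le.2 hy)
  · intro hy
    obtain ⟨x, rfl⟩ := hf.2 y
    refine ⟨x, ?_, rfl⟩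
    by_contra! hx
    rw [hid x hx] at hy
    exact absurd hy (not_le.2 hx)

/-- The determinant of `1 + t A` is polynomial in `t`. -/
theorem exists_polynomial_det_one_add_smul (A : E →L[ℝ] E) :
    ∃ p : ℝ[X], p.natDegree ≤ Module.finrank ℝ E ∧
      ∀ t, p.eval t = (ContinuousLinearMap.id ℝ E + t • A).det := by
  classical
  let b := Module.finBasis ℝ E
  let M := LinearMap.toMatrix b b (A : E →ₗ[ℝ] E)
  refine ⟨((X : ℝ[X]) • M.map C + (1 : Matrix _ _ ℝ).map C).det, ?_, fun t => ?_⟩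
  · simpa using Polynomial.natDegree_det_X_add_C_le M 1
  · rw [← coe_evalRingHom, RingHom.map_det, ContinuousLinearMap.det, ← LinearMap.det_toMatrix b]
    congr 1
    ext i j
    simp only [M, RingHom.mapMatrix_apply, Matrix.map_apply, Matrix.add_apply, Matrix.smul_apply,
      smul_eq_mul, coe_evalRingHom, eval_mul, eval_X, eval_C, ContinuousLinearMap.toLinearMap_add,
      ContinuousLinearMap.toLinearMap_smul, ContinuousLinearMap.coe_id, map_add, map_smul,
      LinearMap.toMatrix_id]
    ring

/-- The value at `1` of a polynomial of bounded degree is a fixed affine combination of its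
values at points arbitrarily close to `0`. -/
theorem exists_affine_combination_eval_one (d : ℕ) {δ : ℝ} (hδ : 0 < δ) :
    ∃ (c v : ℕ → ℝ), (∀ i, |v i| < δ) ∧ ∑ i ∈ Finset.range (d + 1), c i = 1 ∧
      ∀ p : ℝ[X], p.natDegree ≤ d →
        p.eval 1 = ∑ i ∈ Finset.range (d + 1), c i * p.eval (v i) := by
  -- Distinct nodes; the shift by 2 keeps even the first one strictly below δ.
  let v : ℕ → ℝ := fun i => δ / (i + 2)
  have hinj : Set.InjOn v (Finset.range (d + 1)) := by
    intro i _ j _ hij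
    have hi : (0 : ℝ) < i + 2 := by positivity
    have hj : (0 : ℝ) < j + 2 := by positivity
    simp only [v] at hij
    rw [div_eq_div_iff hi.ne' hj.ne'] at hij
    have := mul_left_cancel₀ hδ.ne' hij
    exact_mod_cast (by linarith : (i : ℝ) = j)
  have key : ∀ p : ℝ[X], p.natDegree ≤ d → p.eval 1 =
      ∑ i ∈ Finset.range (d + 1), (Lagrange.basis (Finset.range (d + 1)) v i).eval 1 * p.eval (v i) := by
    intro p hp
    have hdeg : p.degree < (Finset.range (d + 1)).card := by
      rw [Finset.card_range]
      exact lt_of_le_of_lt degree_le_natDegree (by exact_mod_cast Nat.lt_succ_of_le hp)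
    have h := Lagrange.eq_interpolate hinj hdeg
    conv_lhs => rw [h]
    rw [Lagrange.interpolate_apply, eval_finsetSum]
    refine Finset.sum_congr rfl fun i _ => ?_
    rw [eval_mul, eval_C, mul_comm]
  refine ⟨_, v, fun i => ?_, ?_, key⟩
  · have hi : (0 : ℝ) < i + 2 := by positivity
    rw [abs_of_pos (by positivity), div_lt_iff₀ hi]
    have : (0 : ℝ) ≤ i := by positivity
    nlinarith
  · simpa using (key 1 (by simp)).symm

variable [MeasurableSpace E] [BorelSpace E]

/-- Invariance of integrals of functions that are polynomial along lines under compactly supported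
perturbations of the identity. -/
theorem setIntegral_comp_id_add_mul_det {h : E → E} (hh : ContDiff ℝ 1 h) {R : ℝ}
    (hsupp : ∀ x, R ≤ ‖x‖ → h x = 0) {φ : E → ℝ} (hφ : Continuous φ) {d : ℕ}
    (hpoly : ∀ a b : E, ∃ p : ℝ[X], p.natDegree ≤ d ∧ ∀ t : ℝ, p.eval t = φ (a + t • b)) :
    ∫ x in closedBall (0 : E) R, φ (x + h x) * (ContinuousLinearMap.id ℝ E + fderiv ℝ h x).det =
      ∫ x in closedBall (0 : E) R, φ x := by
  have hcs : HasCompactSupport h := by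
    refine HasCompactSupport.intro (isCompact_closedBall (0 : E) R) fun x hx => hsupp x ?_
    simp only [mem_closedBall, dist_zero_right, not_le] at hx
    exact hx.le
  obtain ⟨L, hL⟩ := hh.lipschitzWith_of_hasCompactSupport hcs one_ne_zero
  have hD : Continuous (fderiv ℝ h) := hh.continuous_fderiv one_ne_zero
  have hdiff : Differentiable ℝ h := hh.differentiable one_ne_zero
  have hdet : Continuous fun A : E →L[ℝ] E => A.det := ContinuousLinearMap.continuous_det
  have hcont : Continuous fun q : E × ℝ =>
      (ContinuousLinearMap.id ℝ E + q.2 • fderiv ℝ h q.1).det :=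
    hdet.comp (by fun_prop)
  -- The determinant is 1 at t = 0 and the ball is compact, so for small t the absolute value in the
  -- change of variables can be dropped.
  have hpos : ∀ᶠ t : ℝ in 𝓝 0, ∀ x ∈ closedBall (0 : E) R,
      0 < (ContinuousLinearMap.id ℝ E + t • fderiv ℝ h x).det := by
    refine (isCompact_closedBall (0 : E) R).eventually_forall_of_forall_eventually fun x _ => ?_
    have h0 : 0 < (ContinuousLinearMap.id ℝ E + (0 : ℝ) • fderiv ℝ h x).det := by
      simp [ContinuousLinearMap.det]
    exact ((hcont.comp continuous_swap).tendsto ((0 : ℝ), x)).eventually (lt_mem_nhds h0)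
  have hsmall : ∀ᶠ t : ℝ in 𝓝 0, |t| * L < 1 := by
    have : Tendsto (fun t : ℝ => |t| * L) (𝓝 0) (𝓝 (|0| * L)) :=
      (by fun_prop : Continuous fun t : ℝ => |t| * L).tendsto 0
    exact this.eventually (gt_mem_nhds (by simp))
  obtain ⟨δ, hδ, hball⟩ := Metric.eventually_nhds_iff.1 (hpos.and hsmall)
  set I : ℝ → ℝ := fun t => ∫ x in closedBall (0 : E) R,
    φ (x + t • h x) * (ContinuousLinearMap.id ℝ E + t • fderiv ℝ h x).det with hI
  have hIs : ∀ t : ℝ, |t| < δ → I t = ∫ x in closedBall (0 : E) R, φ x := by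
    intro t ht
    obtain ⟨h1, h2⟩ := hball (by simpa using ht : dist t 0 < δ)
    have hbij := bijective_id_add_smul_of_lipschitz hL h2
    have himg := image_closedBall_eq_of_bijective (R := R) hbij
      (fun x hx => by simp [hsupp x hx.le])
    conv_rhs => rw [← himg]
    rw [integral_image_eq_integral_abs_det_fderiv_smul volume measurableSet_closedBall
      (f := fun x => x + t • h x)
      (f' := fun x => ContinuousLinearMap.id ℝ E + t • fderiv ℝ h x)
      (fun x _ => ((hasFDerivAt_id x).add ((hdiff x).hasFDerivAt.const_smul t)).hasFDerivWithinAt)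
      hbij.1.injOn]
    refine setIntegral_congr_fun measurableSet_closedBall fun x hx => ?_
    simp only [smul_eq_mul]
    rw [abs_of_pos (h1 x hx), mul_comm]
  -- At t = 1 the map need not be injective. The integrand is polynomial in t, however, so its value
  -- at 1 is a combination of values at small t, with coefficients independent of x.
  obtain ⟨c, v, hv, hc1, hc⟩ := exists_affine_combination_eval_one (d + Module.finrank ℝ E) hδ
  have hpt : ∀ x, φ (x + h x) * (ContinuousLinearMap.id ℝ E + fderiv ℝ h x).det =
      ∑ i ∈ Finset.range (d + Module.finrank ℝ E + 1), c i *
        (φ (x + v i • h x) * (ContinuousLinearMap.id ℝ E + v i • fderiv ℝ h x).det) := by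
    intro x
    obtain ⟨p, hp, hpe⟩ := hpoly x (h x)
    obtain ⟨q, hq, hqe⟩ := exists_polynomial_det_one_add_smul (fderiv ℝ h x)
    have := hc (p * q) (natDegree_mul_le.trans (add_le_add hp hq))
    simpa [eval_mul, hpe, hqe] using this
  have hint : ∀ t : ℝ, IntegrableOn (fun x =>
      φ (x + t • h x) * (ContinuousLinearMap.id ℝ E + t • fderiv ℝ h x).det)
      (closedBall (0 : E) R) := by
    intro t
    refine ContinuousOn.integrableOn_compact (isCompact_closedBall _ _) (Continuous.continuousOn ?_)
    have h1 : Continuous h := hh.continuous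
    exact (hφ.comp (by fun_prop)).mul (hcont.comp (by fun_prop : Continuous fun x : E => (x, t)))
  simp_rw [hpt]
  rw [integral_finsetSum _ fun i _ => (hint (v i)).const_mul (c i)]
  simp_rw [integral_const_mul]
  rw [Finset.sum_congr rfl fun i _ => by rw [show (∫ x in closedBall (0 : E) R,
    φ (x + v i • h x) * (ContinuousLinearMap.id ℝ E + v i • fderiv ℝ h x).det) = _ from
      hIs (v i) (hv i)]]
  rw [← Finset.sum_mul, hc1, one_mul]

/-- A compactly supported `C¹` perturbation of the identity has a zero. -/
theorem exists_add_eq_zero_of_compact_support {h : E → E} (hh : ContDiff ℝ 1 h) {R : ℝ}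
    (hR : 0 < R) (hsupp : ∀ x, R ≤ ‖x‖ → h x = 0) : ∃ x, x + h x = 0 := by
  by_contra! hne
  have hcont : Continuous fun x => ‖x + h x‖ := by have := hh.continuous; fun_prop
  have hB := isCompact_closedBall (0 : E) R
  have h0B : (closedBall (0 : E) R).Nonempty := ⟨0, by simp [hR.le]⟩
  obtain ⟨x₀, -, hx₀⟩ := hB.exists_isMinOn h0B hcont.continuousOn
  obtain ⟨x₁, -, hx₁⟩ := hB.exists_isMaxOn h0B hcont.continuousOn
  set c := min ‖x₀ + h x₀‖ R
  have hc : 0 < c := lt_min (norm_pos_iff.2 (hne _)) hR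
  set ρ := max ‖x₁ + h x₁‖ R
  have hρ : 0 < ρ := lt_max_of_lt_right hR
  have hcρ : c ≤ ρ := (min_le_right _ _).trans (le_max_right _ _)
  set a := c ^ 2 / ρ ^ 2
  have ha : 0 < a := by positivity
  have ha1 : a ≤ 1 := by
    rw [div_le_one (by positivity)]
    gcongr
  -- These functions concentrate at 0 as m grows. If x + h x stays at distance at least c from 0,
  -- the transformed integral is O((1−a)^m), while ∫ φ is at least a constant times (1−a/4)^m, from
  -- the ball of radius c/2.
  let φ : ℕ → E → ℝ := fun m y => (1 - ‖y‖ ^ 2 / ρ ^ 2) ^ m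
  have hφc : ∀ m, Continuous (φ m) := fun m => by fun_prop
  have hkey : ∀ m, ∫ x in closedBall (0 : E) R,
      φ m (x + h x) * (ContinuousLinearMap.id ℝ E + fderiv ℝ h x).det =
      ∫ x in closedBall (0 : E) R, φ m x := by
    intro m
    refine setIntegral_comp_id_add_mul_det hh hsupp (hφc m) (d := 2 * m) fun u w => ?_
    refine ⟨(C (1 - ‖u‖ ^ 2 / ρ ^ 2) - C (2 * inner ℝ u w / ρ ^ 2) * X
      - C (‖w‖ ^ 2 / ρ ^ 2) * X ^ 2) ^ m, ?_, fun t => ?_⟩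
    · refine natDegree_pow_le.trans ?_
      rw [mul_comm]
      gcongr
      compute_degree
    · simp only [eval_pow, eval_sub, eval_mul, eval_C, eval_X, φ]
      rw [norm_add_sq_real, inner_smul_right, norm_smul, mul_pow, Real.norm_eq_abs, sq_abs]
      congr 1
      ring
  set D : E → ℝ := fun x => |(ContinuousLinearMap.id ℝ E + fderiv ℝ h x).det|
  have hDc : Continuous fun x => (ContinuousLinearMap.id ℝ E + fderiv ℝ h x).det :=
    ContinuousLinearMap.continuous_det.comp
      (continuous_const.add (hh.continuous_fderiv one_ne_zero))
  have hup : ∀ m, ∫ x in closedBall (0 : E) R,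
      φ m (x + h x) * (ContinuousLinearMap.id ℝ E + fderiv ℝ h x).det ≤
      (1 - a) ^ m * ∫ x in closedBall (0 : E) R, D x := by
    intro m
    rw [← integral_const_mul]
    refine setIntegral_mono_on ?_ ?_ measurableSet_closedBall fun x hx => ?_
    · refine ContinuousOn.integrableOn_compact hB (Continuous.continuousOn ?_)
      have := hh.continuous
      exact ((hφc m).comp (by fun_prop)).mul hDc
    · exact (ContinuousOn.integrableOn_compact hB hDc.abs.continuousOn).const_mul _
    · have h1 : c ≤ ‖x + h x‖ := (min_le_left _ _).trans (hx₀ hx)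
      have h2 : ‖x + h x‖ ≤ ρ := le_trans (hx₁ hx) (le_max_left _ _)
      have h3 : 0 ≤ 1 - ‖x + h x‖ ^ 2 / ρ ^ 2 := by
        rw [sub_nonneg, div_le_one (by positivity)]
        gcongr
      have h4 : 1 - ‖x + h x‖ ^ 2 / ρ ^ 2 ≤ 1 - a := by
        simp only [a]
        gcongr
      calc _ ≤ φ m (x + h x) * D x := by
            exact mul_le_mul_of_nonneg_left (le_abs_self _) (pow_nonneg h3 m)
        _ ≤ _ := mul_le_mul_of_nonneg_right (pow_le_pow_left₀ h3 h4 m) (abs_nonneg _)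
  have hlow : ∀ m, (1 - a / 4) ^ m * volume.real (closedBall (0 : E) (c / 2)) ≤
      ∫ x in closedBall (0 : E) R, φ m x := by
    intro m
    have hnn : ∀ x ∈ closedBall (0 : E) R, 0 ≤ 1 - ‖x‖ ^ 2 / ρ ^ 2 := by
      intro x hx
      rw [sub_nonneg, div_le_one (by positivity)]
      have : ‖x‖ ≤ ρ := le_trans (by simpa using hx) (le_max_right _ _)
      gcongr
    have hsub : closedBall (0 : E) (c / 2) ⊆ closedBall 0 R :=
      closedBall_subset_closedBall (by linarith [min_le_right ‖x₀ + h x₀‖ R])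
    calc _ = ∫ x in closedBall (0 : E) (c / 2), (1 - a / 4) ^ m := by
          rw [setIntegral_const, smul_eq_mul, mul_comm]
      _ ≤ ∫ x in closedBall (0 : E) (c / 2), φ m x := by
          refine setIntegral_mono_on (by
            exact (ContinuousOn.integrableOn_compact (isCompact_closedBall _ _) continuousOn_const))
            (ContinuousOn.integrableOn_compact (isCompact_closedBall _ _) (hφc m).continuousOn)
            measurableSet_closedBall fun x hx => ?_
          have hx' : ‖x‖ ≤ c / 2 := by simpa using hx
          refine pow_le_pow_left₀ (by linarith) ?_ m
          have : ‖x‖ ^ 2 ≤ (c / 2) ^ 2 := by gcongr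
          have : ‖x‖ ^ 2 / ρ ^ 2 ≤ (c / 2) ^ 2 / ρ ^ 2 := by gcongr
          have h4 : (c / 2) ^ 2 / ρ ^ 2 = a / 4 := by simp only [a]; ring
          linarith
      _ ≤ _ := by
          refine setIntegral_mono_set
            (ContinuousOn.integrableOn_compact hB (hφc m).continuousOn) ?_ hsub.eventuallyLE
          filter_upwards [ae_restrict_mem measurableSet_closedBall] with x hx
          exact pow_nonneg (hnn x hx) m
  have hV : 0 < volume.real (closedBall (0 : E) (c / 2)) := by
    refine ENNReal.toReal_pos (measure_closedBall_pos volume 0 (by positivity)).ne' ?_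
    exact measure_closedBall_lt_top.ne
  set V := volume.real (closedBall (0 : E) (c / 2))
  set J := ∫ x in closedBall (0 : E) R, D x
  have hb : 0 < 1 - a / 4 := by linarith
  have hall : ∀ m : ℕ, V ≤ ((1 - a) / (1 - a / 4)) ^ m * J := by
    intro m
    have := (hlow m).trans ((hkey m).symm.le.trans (hup m))
    rw [div_pow, div_mul_eq_mul_div, le_div_iff₀ (by positivity)]
    linarith
  have hlim : Tendsto (fun m : ℕ => ((1 - a) / (1 - a / 4)) ^ m * J) atTop (𝓝 (0 * J)) := by
    refine Tendsto.mul_const _ (tendsto_pow_atTop_nhds_zero_of_lt_one ?_ ?_)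
    · exact div_nonneg (by linarith) hb.le
    · rw [div_lt_one hb]; linarith
  have := ge_of_tendsto' hlim hall
  rw [zero_mul] at this
  linarith

-- A partition of unity glues the local constants f(x), since balls are convex.
omit [MeasurableSpace E] [BorelSpace E] in
theorem exists_contDiff_norm_sub_lt {f : E → E} (hf : Continuous f) {ε : ℝ} (hε : 0 < ε) :
    ∃ g : E → E, ContDiff ℝ 1 g ∧ ∀ x, ‖g x - f x‖ < ε := by
  obtain ⟨g, hg⟩ := exists_contMDiffMap_forall_mem_convex_of_local_const (n := 1)
    (modelWithCornersSelf ℝ E) (t := fun x => ball (f x) ε) (fun x => convex_ball _ _) fun x =>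
      ⟨f x, by
        filter_upwards [hf.tendsto x (ball_mem_nhds (f x) hε)] with y hy
        exact mem_ball'.2 hy⟩
  refine ⟨g, g.contMDiff.contDiff, fun x => ?_⟩
  simpa [dist_eq_norm] using hg x

/-- **Brouwer's fixed point theorem**, for continuous bounded self-maps of a Euclidean space. -/
theorem exists_fixedPoint_of_continuous_of_bounded {f : E → E} (hf : Continuous f) {R : ℝ}
    (hR : ∀ x, ‖f x‖ ≤ R) : ∃ x, f x = x := by
  by_contra! hne
  have hR0 : 0 ≤ R := (norm_nonneg _).trans (hR 0)
  obtain ⟨x₀, -, hx₀⟩ := (isCompact_closedBall (0 : E) (R + 2)).exists_isMinOn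
    ⟨0, by simp; linarith⟩ (f := fun x => ‖f x - x‖) (by fun_prop)
  set ε := min ‖f x₀ - x₀‖ 1
  have hε : 0 < ε := lt_min (norm_pos_iff.2 (sub_ne_zero.2 (hne x₀))) one_pos
  have hε1 : ε ≤ 1 := min_le_right _ _
  obtain ⟨g, hg, hgf⟩ := exists_contDiff_norm_sub_lt hf hε
  -- A zero of x − χ(x)g(x) has ‖x‖ ≤ R + 1, where χ = 1, so it is a true fixed point of g. There f
  -- moves x by less than its minimal displacement.
  let χ : ContDiffBump (0 : E) := ⟨R + 2, R + 3, by linarith, by linarith⟩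
  obtain ⟨x, hx⟩ := exists_add_eq_zero_of_compact_support (h := fun x => -(χ x • g x)) (R := R + 3)
    ((χ.contDiff.smul hg).neg) (by linarith) (fun x hx => by
      rw [χ.zero_of_le_dist (by simpa using hx)]; simp)
  have hxe : x = χ x • g x := by rw [← sub_eq_zero, sub_eq_add_neg]; exact hx
  have hgx : ‖g x‖ ≤ R + 1 := by
    calc ‖g x‖ = ‖(g x - f x) + f x‖ := by simp
      _ ≤ ‖g x - f x‖ + ‖f x‖ := norm_add_le _ _
      _ ≤ _ := by linarith [hgf x, hR x]
  have hxn : ‖x‖ ≤ R + 1 := by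
    rw [hxe, norm_smul, Real.norm_of_nonneg χ.nonneg]
    calc _ ≤ 1 * ‖g x‖ := by gcongr; exact χ.le_one
      _ ≤ _ := by linarith
  have hχ : χ x = 1 := χ.one_of_mem_closedBall (by simp [χ]; linarith)
  rw [hχ, one_smul] at hxe
  have h1 := hgf x
  rw [← hxe, norm_sub_rev] at h1
  have h2 : ‖f x₀ - x₀‖ ≤ ‖f x - x‖ := hx₀ (by simp; linarith)
  linarith [min_le_left ‖f x₀ - x₀‖ 1]

end Brouwer

noncomputable section
namespace Nekrasov

open Filter Topology Real

/-! ### The L² norm of the kernel in one variable, by Fourier series -/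

section Kernel

/-- Fatou's lemma. It serves both limits: partial sums to Abel means, and Abel means to the kernel.
-/
theorem lintegral_enorm_sq_le_of_tendsto {X : Type*} [MeasurableSpace X] {μ : Measure X}
    {f : ℕ → X → ℝ} {g : X → ℝ} (hf : ∀ n, AEMeasurable (f n) μ)
    (hlim : ∀ᵐ x ∂μ, Tendsto (fun n => f n x) atTop (𝓝 (g x))) {C : ENNReal}
    (hC : ∀ n, ∫⁻ x, ‖f n x‖ₑ ^ 2 ∂μ ≤ C) : ∫⁻ x, ‖g x‖ₑ ^ 2 ∂μ ≤ C := by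
  calc ∫⁻ x, ‖g x‖ₑ ^ 2 ∂μ = ∫⁻ x, liminf (fun n => ‖f n x‖ₑ ^ 2) atTop ∂μ := by
        refine lintegral_congr_ae ?_
        filter_upwards [hlim] with x hx
        exact (ENNReal.Tendsto.pow hx.enorm).liminf_eq.symm
    _ ≤ liminf (fun n => ∫⁻ x, ‖f n x‖ₑ ^ 2 ∂μ) atTop :=
        lintegral_liminf_le' fun n => (hf n).enorm.pow_const _
    _ ≤ C := liminf_le_of_frequently_le' (Frequently.of_forall hC)

theorem integral_cos_two_mul_int_mul {k : ℤ} (hk : k ≠ 0) :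
    ∫ s in (0 : ℝ)..(π / 2), cos (2 * k * s) = 0 := by
  have h2 : (2 * k : ℝ) ≠ 0 := by exact_mod_cast mul_ne_zero two_ne_zero hk
  rw [intervalIntegral.integral_comp_mul_left (fun x => cos x) h2, integral_cos]
  have : (2 * k : ℝ) * (π / 2) = k * π := by ring
  rw [this, Real.sin_int_mul_pi]
  simp

theorem integral_sin_mul_sin (m n : ℕ) :
    ∫ s in (0 : ℝ)..(π / 2), sin (2 * m * s) * sin (2 * n * s) =
      if m = n ∧ m ≠ 0 then π / 4 else 0 := by
  have h : ∀ s : ℝ, sin (2 * m * s) * sin (2 * n * s) =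
      1 / 2 * (cos (2 * ((m - n : ℤ) : ℝ) * s) - cos (2 * ((m + n : ℤ) : ℝ) * s)) := by
    intro s
    have h1 : 2 * ((m - n : ℤ) : ℝ) * s = 2 * m * s - 2 * n * s := by push_cast; ring
    have h2 : 2 * ((m + n : ℤ) : ℝ) * s = 2 * m * s + 2 * n * s := by push_cast; ring
    rw [h1, h2, cos_sub, cos_add]
    ring
  simp_rw [h]
  rw [intervalIntegral.integral_const_mul, intervalIntegral.integral_sub
    (Continuous.intervalIntegrable (by fun_prop) _ _)
    (Continuous.intervalIntegrable (by fun_prop) _ _)]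
  by_cases hm : m = 0
  · subst hm
    rcases eq_or_ne n 0 with rfl | hn
    · simp
    · rw [integral_cos_two_mul_int_mul (by simpa using hn),
        integral_cos_two_mul_int_mul (by simpa using hn)]
      simp
  · have h2 : ((m : ℤ) + n) ≠ 0 := by positivity
    rw [integral_cos_two_mul_int_mul h2]
    by_cases hmn : m = n
    · subst hmn
      simp [hm]
      ring
    · rw [integral_cos_two_mul_int_mul (sub_ne_zero.2 (by exact_mod_cast hmn))]
      simp [hmn]

/-- The mode n = 0 vanishes identically, so its coefficient must be zero for the right side to be
correct. -/
theorem integral_sq_sum_sin {a : ℕ → ℝ} (ha : a 0 = 0) (N : ℕ) :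
    ∫ s in (0 : ℝ)..(π / 2), (∑ n ∈ Finset.range N, a n * sin (2 * n * s)) ^ 2 =
      ∑ n ∈ Finset.range N, π / 4 * a n ^ 2 := by
  have h : ∀ s : ℝ, (∑ n ∈ Finset.range N, a n * sin (2 * n * s)) ^ 2 =
      ∑ m ∈ Finset.range N, ∑ n ∈ Finset.range N,
        (a m * a n) * (sin (2 * m * s) * sin (2 * n * s)) := by
    intro s
    rw [sq, Finset.sum_mul_sum]
    refine Finset.sum_congr rfl fun m _ => Finset.sum_congr rfl fun n _ => by ring
  simp_rw [h]
  rw [intervalIntegral.integral_finsetSum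
    fun m _ => Continuous.intervalIntegrable (by fun_prop) _ _]
  refine Finset.sum_congr rfl fun m hm => ?_
  rw [intervalIntegral.integral_finsetSum
    fun n _ => Continuous.intervalIntegrable (by fun_prop) _ _]
  simp_rw [intervalIntegral.integral_const_mul, integral_sin_mul_sin]
  rw [Finset.sum_eq_single_of_mem m hm]
  · by_cases h0 : m = 0
    · subst h0; simp [ha]
    · simp [h0]; ring
  · intro n _ hn
    rw [if_neg (fun h => hn h.1.symm), mul_zero]

theorem lintegral_enorm_sq_sum_sin_le {a : ℕ → ℝ} (ha : a 0 = 0) {C : ℝ} (N : ℕ)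
    (hC : ∑ n ∈ Finset.range N, π / 4 * a n ^ 2 ≤ C) :
    ∫⁻ s in Ioo 0 (π / 2), ‖∑ n ∈ Finset.range N, a n * sin (2 * n * s)‖ₑ ^ 2 ≤
      ENNReal.ofReal C := by
  have hpi : (0 : ℝ) ≤ π / 2 := by positivity
  have hc : Continuous fun s : ℝ => (∑ n ∈ Finset.range N, a n * sin (2 * n * s)) ^ 2 := by
    fun_prop
  calc _ = ∫⁻ s in Ioo 0 (π / 2),
        ENNReal.ofReal ((∑ n ∈ Finset.range N, a n * sin (2 * n * s)) ^ 2) := by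
        refine lintegral_congr fun s => ?_
        rw [← sq_abs, ENNReal.ofReal_pow (abs_nonneg _), Real.enorm_eq_ofReal_abs]
    _ = ENNReal.ofReal (∫ s in Ioo 0 (π / 2),
        (∑ n ∈ Finset.range N, a n * sin (2 * n * s)) ^ 2) := by
        rw [ofReal_integral_eq_lintegral_ofReal]
        · exact (hc.integrableOn_Icc).mono_set Ioo_subset_Icc_self
        · exact Eventually.of_forall fun s => sq_nonneg _
    _ ≤ _ := by
        rw [← integral_Ioc_eq_integral_Ioo, ← intervalIntegral.integral_of_le hpi,
          integral_sq_sum_sin ha]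
        exact ENNReal.ofReal_le_ofReal hC

/-- Write sin² x = (1 − cos 2x)/2 and use the Fourier series of the Bernoulli polynomial B₂ at 2σ/π
and at 0. The term n = 0 is 0/0 = 0. -/
theorem hasSum_sin_sq_div_sq {σ : ℝ} (hσ : σ ∈ Icc 0 (π / 2)) :
    HasSum (fun n : ℕ => sin (2 * n * σ) ^ 2 / (n : ℝ) ^ 2) (σ * (π - 2 * σ)) := by
  have hx : 2 * σ / π ∈ Icc (0 : ℝ) 1 := by
    refine ⟨by have := hσ.1; positivity, ?_⟩
    rw [div_le_one pi_pos]; linarith [hσ.2]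
  have h1 := hasSum_one_div_nat_pow_mul_cos one_ne_zero hx
  have h0 := hasSum_one_div_nat_pow_mul_cos one_ne_zero (left_mem_Icc.2 zero_le_one)
  have hb : ∀ x : ℝ, (Polynomial.map (algebraMap ℚ ℝ) (Polynomial.bernoulli (2 * 1))).eval x =
      x ^ 2 - x + 6⁻¹ := fun x => bernoulliFun_two x
  rw [hb] at h1 h0
  have h := (h0.sub h1).mul_left (1 / 2)
  convert! h using 1
  · ext n
    have h4 : 2 * π * n * (2 * σ / π) = 2 * (2 * n * σ) := by field_simp
    rw [h4, cos_two_mul, cos_sq']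
    simp
    ring
  · simp
    field_simp
    ring

/-- Real part of the Taylor series of −log(1−z) at z = r e^{iθ}. -/
theorem hasSum_pow_mul_cos {r : ℝ} (hr : r ∈ Ico (0 : ℝ) 1) (θ : ℝ) :
    HasSum (fun n : ℕ => r ^ n / n * cos (n * θ)) (-log ‖1 - r * Complex.exp (Complex.I * θ)‖) := by
  have hz : ‖(r : ℂ) * Complex.exp (Complex.I * θ)‖ < 1 := by
    rw [norm_mul, Complex.norm_exp_I_mul_ofReal, mul_one, Complex.norm_real,
      Real.norm_of_nonneg hr.1]
    exact hr.2
  have h := Complex.hasSum_re (Complex.hasSum_taylorSeries_neg_log hz)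
  rw [Complex.neg_re, Complex.log_re] at h
  convert! h using 2 with n
  rw [mul_pow, ← Complex.exp_nat_mul, mul_div_right_comm]
  have : (n : ℂ) * (Complex.I * θ) = ((n * θ : ℝ) : ℂ) * Complex.I := by push_cast; ring
  rw [this]
  have h2 : ((r : ℂ) ^ n / n) = ((r ^ n / n : ℝ) : ℂ) := by push_cast; rfl
  rw [h2, Complex.re_ofReal_mul, Complex.exp_ofReal_mul_I_re]

/-- The Abel means of the Fourier series of the kernel. -/
def abelKernel (r s σ : ℝ) : ℝ :=
  log ‖1 - r * Complex.exp (Complex.I * (2 * (s + σ) : ℝ))‖ -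
    log ‖1 - r * Complex.exp (Complex.I * (2 * (s - σ) : ℝ))‖

theorem hasSum_abelKernel {r : ℝ} (hr : r ∈ Ico (0 : ℝ) 1) (s σ : ℝ) :
    HasSum (fun n : ℕ => (r ^ n * (2 / n) * sin (2 * n * σ)) * sin (2 * n * s))
      (abelKernel r s σ) := by
  have h := (hasSum_pow_mul_cos hr (2 * (s - σ))).sub (hasSum_pow_mul_cos hr (2 * (s + σ)))
  convert! h using 1
  · ext n
    have h1 : n * (2 * (s - σ)) = 2 * n * s - 2 * n * σ := by ring
    have h2 : n * (2 * (s + σ)) = 2 * n * s + 2 * n * σ := by ring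
    rw [h1, h2, cos_sub, cos_add]
    ring
  · rw [abelKernel]; ring

theorem norm_one_sub_exp (θ : ℝ) : ‖1 - Complex.exp (Complex.I * (2 * θ : ℝ))‖ = 2 * |sin θ| := by
  rw [norm_sub_rev, Complex.norm_exp_I_mul_ofReal_sub_one]
  simp

/-- As r → 1 the two norms tend to 2|sin(s ± σ)|, and the factor 2 cancels in the quotient. -/
theorem tendsto_abelKernel {s σ : ℝ} (h1 : sin (s + σ) ≠ 0) (h2 : sin (s - σ) ≠ 0) {r : ℕ → ℝ}
    (hr : Tendsto r atTop (𝓝 1)) :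
    Tendsto (fun n => abelKernel (r n) s σ) atTop (𝓝 (K s σ)) := by
  have key : ∀ θ : ℝ, sin θ ≠ 0 → Tendsto (fun n =>
      log ‖1 - (r n : ℂ) * Complex.exp (Complex.I * (2 * θ : ℝ))‖) atTop (𝓝 (log (2 * |sin θ|))) := by
    intro θ hθ
    refine Tendsto.log ?_ (by positivity)
    rw [← norm_one_sub_exp]
    have hc : Continuous fun x : ℝ => ‖1 - (x : ℂ) * Complex.exp (Complex.I * (2 * θ : ℝ))‖ := by
      fun_prop
    have := (hc.tendsto 1).comp hr
    simpa [Function.comp_def] using this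
  have hK : K s σ = log (2 * |sin (s + σ)|) - log (2 * |sin (s - σ)|) := by
    rw [K, ← log_div (by positivity) (by positivity), mul_div_mul_left _ _ two_ne_zero, abs_div]
  rw [hK]
  exact (key _ h1).sub (key _ h2)

/-- The `L²`-norm of the kernel in one variable. -/
theorem lintegral_enorm_K_sq_le {σ : ℝ} (hσ : σ ∈ Ioo 0 (π / 2)) :
    ∫⁻ s in Ioo 0 (π / 2), ‖K s σ‖ₑ ^ 2 ≤ ENNReal.ofReal (π * (σ * (π - 2 * σ))) := by
  let r : ℕ → ℝ := fun n => 1 - 1 / ((n : ℝ) + 1)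
  have hr : ∀ n, r n ∈ Ico (0 : ℝ) 1 := by
    intro n
    have h1 : (0 : ℝ) < n + 1 := by positivity
    refine ⟨?_, ?_⟩
    · simp only [r, sub_nonneg]
      rw [div_le_one h1]
      have : (0 : ℝ) ≤ n := by positivity
      linarith
    · simp only [r, sub_lt_self_iff]; positivity
  have hr1 : Tendsto r atTop (𝓝 1) := by
    have := tendsto_one_div_add_atTop_nhds_zero_nat (𝕜 := ℝ)
    simpa [r] using this.const_sub 1
  have hmeas : ∀ ρ : ℝ, Measurable fun s => abelKernel ρ s σ := by
    intro ρ
    unfold abelKernel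
    fun_prop
  have hstep : ∀ ρ ∈ Ico (0 : ℝ) 1, ∫⁻ s in Ioo 0 (π / 2), ‖abelKernel ρ s σ‖ₑ ^ 2 ≤
      ENNReal.ofReal (π * (σ * (π - 2 * σ))) := by
    intro ρ hρ
    refine lintegral_enorm_sq_le_of_tendsto
      (f := fun N s => ∑ n ∈ Finset.range N, (ρ ^ n * (2 / n) * sin (2 * n * σ)) * sin (2 * n * s))
      (fun N => (Continuous.measurable (by fun_prop)).aemeasurable)
      (Eventually.of_forall fun s => (hasSum_abelKernel hρ s σ).tendsto_sum_nat) fun N => ?_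
    refine lintegral_enorm_sq_sum_sin_le (by simp) N ?_
    have hs := (hasSum_sin_sq_div_sq (Ioo_subset_Icc_self hσ)).mul_left π
    refine le_trans (Finset.sum_le_sum fun n _ => ?_)
      (sum_le_hasSum (Finset.range N) (fun n _ => by positivity) hs)
    -- Dropping the Abel factor makes the bound uniform in ρ, as the limit ρ → 1 requires.
    have hp : (ρ ^ n) ^ 2 ≤ 1 := pow_le_one₀ (pow_nonneg hρ.1 n) (pow_le_one₀ hρ.1 hρ.2.le)
    calc π / 4 * (ρ ^ n * (2 / n) * sin (2 * n * σ)) ^ 2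
        = (ρ ^ n) ^ 2 * (π * (sin (2 * n * σ) ^ 2 / (n : ℝ) ^ 2)) := by ring
      _ ≤ 1 * (π * (sin (2 * n * σ) ^ 2 / (n : ℝ) ^ 2)) := by gcongr
      _ = _ := one_mul _
  refine lintegral_enorm_sq_le_of_tendsto (f := fun n s => abelKernel (r n) s σ)
    (fun n => (hmeas _).aemeasurable) ?_ fun n => hstep _ (hr n)
  have hne : ∀ᵐ s ∂(volume.restrict (Ioo 0 (π / 2))), s ≠ σ :=
    ae_restrict_of_ae (by simp [ae_iff])
  filter_upwards [hne, ae_restrict_mem measurableSet_Ioo] with s hs hsI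
  refine tendsto_abelKernel ?_ ?_ hr1
  · exact (sin_pos_of_pos_of_lt_pi (by linarith [hσ.1, hsI.1]) (by linarith [hσ.2, hsI.2])).ne'
  · rcases lt_or_gt_of_ne hs with h | h
    · exact (sin_neg_of_neg_of_neg_pi_lt (by linarith) (by linarith [hσ.2, hsI.1, pi_pos])).ne
    · exact (sin_pos_of_pos_of_lt_pi (by linarith) (by linarith [hσ.1, hsI.2, pi_pos])).ne'

end Kernel
-- Hardy's inequality for cot · H, by a Schur test
section Hardy

/-- A primitive of `log |(1 + u²) / (1 - u²)|`. -/
def logPrimitive (u : ℝ) : ℝ :=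
  u * log (1 + u ^ 2) - (1 + u) * log (1 + u) + (1 - u) * log (1 - u) + 2 * arctan u

/-- With 0 log 0 = 0 the primitive has no jump at u = 1, so it integrates across the logarithmic
singularity. -/
theorem continuous_logPrimitive : Continuous logPrimitive := by
  have h : Continuous fun x : ℝ => x * log x := continuous_mul_log
  have h1 : Continuous fun u : ℝ => (1 + u) * log (1 + u) := h.comp (by fun_prop)
  have h2 : Continuous fun u : ℝ => (1 - u) * log (1 - u) := h.comp (by fun_prop)
  have h3 : Continuous fun u : ℝ => u * log (1 + u ^ 2) :=
    continuous_id.mul (Continuous.log (by fun_prop) fun u => by positivity)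
  exact ((h3.sub h1).add h2).add (continuous_arctan.const_mul 2)

theorem hasDerivAt_logPrimitive {u : ℝ} (h0 : 0 < u) (h1 : u ≠ 1) :
    HasDerivAt logPrimitive (log |(1 + u ^ 2) / (1 - u ^ 2)|) u := by
  have hp : (1 + u ^ 2) ≠ 0 := by positivity
  have hp1 : (1 + u) ≠ 0 := by positivity
  have hm : (1 - u) ≠ 0 := sub_ne_zero.2 h1.symm
  have hid := hasDerivAt_id u
  have hA := hid.mul (((hid.pow 2).const_add 1).log hp)
  have hB := (hid.const_add 1).mul ((hid.const_add 1).log hp1)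
  have hC := (hid.const_sub 1).mul ((hid.const_sub 1).log hm)
  have := ((hA.sub hB).add hC).add ((hasDerivAt_arctan u).const_mul 2)
  convert! this using 1
  have hfac : (1 : ℝ) - u ^ 2 = (1 + u) * (1 - u) := by ring
  rw [log_abs, log_div hp (by rw [hfac]; exact mul_ne_zero hp1 hm), hfac, log_mul hp1 hm]
  simp
  field_simp
  ring

/-- For u > 1, regroup as u log((u²+1)/(u²−1)) + log((u−1)/(u+1)) + 2 arctan u; the first two terms
vanish at infinity. -/
theorem tendsto_logPrimitive : Tendsto logPrimitive atTop (𝓝 π) := by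
  have h1 : Tendsto (fun u : ℝ => u * (log (1 + u ^ 2) - log (u ^ 2 - 1))) atTop (𝓝 0) := by
    have hb : Tendsto (fun u : ℝ => 2 / (u - 1)) atTop (𝓝 0) :=
      Tendsto.const_div_atTop (tendsto_atTop_add_const_right _ _ tendsto_id) 2
    refine squeeze_zero' ?_ ?_ hb
    · filter_upwards [eventually_gt_atTop 1] with u hu
      have : (0 : ℝ) < u ^ 2 - 1 := by nlinarith
      have : log (u ^ 2 - 1) ≤ log (1 + u ^ 2) := log_le_log this (by linarith)
      exact mul_nonneg (by linarith) (by linarith)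
    · filter_upwards [eventually_gt_atTop 1] with u hu
      have hq : (0 : ℝ) < u ^ 2 - 1 := by nlinarith
      rw [← log_div (by positivity) hq.ne']
      have h2 := log_le_sub_one_of_pos (show (0 : ℝ) < (1 + u ^ 2) / (u ^ 2 - 1) by positivity)
      have h3 : (1 + u ^ 2) / (u ^ 2 - 1) - 1 = 2 / (u ^ 2 - 1) := by field_simp; ring
      rw [h3] at h2
      calc u * log ((1 + u ^ 2) / (u ^ 2 - 1)) ≤ u * (2 / (u ^ 2 - 1)) := by gcongr
        _ ≤ 2 / (u - 1) := by
          rw [← mul_div_assoc, div_le_div_iff₀ hq (by linarith)]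
          nlinarith
  have h2 : Tendsto (fun u : ℝ => log (1 - 2 / (u + 1))) atTop (𝓝 0) := by
    have hb : Tendsto (fun u : ℝ => 2 / (u + 1)) atTop (𝓝 0) :=
      Tendsto.const_div_atTop (tendsto_atTop_add_const_right _ _ tendsto_id) 2
    have := (hb.const_sub 1).log (by norm_num)
    simpa using this
  have h3 : Tendsto (fun u : ℝ => 2 * arctan u) atTop (𝓝 (2 * (π / 2))) :=
    (tendsto_nhds_of_tendsto_nhdsWithin tendsto_arctan_atTop).const_mul 2
  have h := (h1.add h2).add h3
  rw [show (0 : ℝ) + 0 + 2 * (π / 2) = π by ring] at h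
  refine h.congr' ?_
  filter_upwards [eventually_gt_atTop 1] with u hu
  have hm : (u - 1) ≠ 0 := by linarith
  have hp : (u + 1) ≠ 0 := by linarith
  rw [show (1 : ℝ) - 2 / (u + 1) = (u - 1) / (u + 1) by field_simp; ring, log_div hm hp,
    show u ^ 2 - 1 = (u + 1) * (u - 1) by ring, log_mul hp hm, logPrimitive,
    ← log_neg_eq_log (1 - u), neg_sub, add_comm 1 u]
  ring

theorem log_abs_div_nonneg (u : ℝ) : 0 ≤ log |(1 + u ^ 2) / (1 - u ^ 2)| := by
  by_cases h : (1 : ℝ) - u ^ 2 = 0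
  · simp [h]
  · refine log_nonneg ?_
    rw [abs_div, one_le_div (abs_pos.2 h), abs_of_nonneg (by positivity : (0 : ℝ) ≤ 1 + u ^ 2), abs_le]
    constructor <;> nlinarith [sq_nonneg u]

theorem lintegral_log_abs_div :
    ∫⁻ u in Ioi 0, ENNReal.ofReal (log |(1 + u ^ 2) / (1 - u ^ 2)|) = ENNReal.ofReal π := by
  have hnn : ∀ S : Set ℝ, 0 ≤ᵐ[volume.restrict S] fun u => log |(1 + u ^ 2) / (1 - u ^ 2)| :=
    fun S => Eventually.of_forall fun u => log_abs_div_nonneg u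
  have hd1 : ∀ x ∈ Ioo (0 : ℝ) 1, HasDerivAt logPrimitive (log |(1 + x ^ 2) / (1 - x ^ 2)|) x :=
    fun x hx => hasDerivAt_logPrimitive hx.1 hx.2.ne
  have hd2 : ∀ x ∈ Ioi (1 : ℝ), HasDerivAt logPrimitive (log |(1 + x ^ 2) / (1 - x ^ 2)|) x :=
    fun x hx => hasDerivAt_logPrimitive (zero_lt_one.trans hx) (ne_of_gt hx)
  have hi1 : IntegrableOn (fun u : ℝ => log |(1 + u ^ 2) / (1 - u ^ 2)|) (Ioc 0 1) :=
    intervalIntegral.integrableOn_deriv_of_nonneg continuous_logPrimitive.continuousOn hd1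
      fun x _ => log_abs_div_nonneg x
  have hi2 : IntegrableOn (fun u : ℝ => log |(1 + u ^ 2) / (1 - u ^ 2)|) (Ioi 1) :=
    integrableOn_Ioi_deriv_of_nonneg continuous_logPrimitive.continuousWithinAt hd2
      (fun x _ => log_abs_div_nonneg x) tendsto_logPrimitive
  have hI1 : ∫ u in Ioc (0 : ℝ) 1, log |(1 + u ^ 2) / (1 - u ^ 2)| =
      logPrimitive 1 - logPrimitive 0 := by
    rw [← intervalIntegral.integral_of_le zero_le_one]
    exact intervalIntegral.integral_eq_sub_of_hasDerivAt_of_le zero_le_one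
      continuous_logPrimitive.continuousOn hd1
      ((intervalIntegrable_iff_integrableOn_Ioc_of_le zero_le_one).2 hi1)
  have hI2 : ∫ u in Ioi (1 : ℝ), log |(1 + u ^ 2) / (1 - u ^ 2)| = π - logPrimitive 1 :=
    integral_Ioi_of_hasDerivAt_of_nonneg continuous_logPrimitive.continuousWithinAt hd2
      (fun x _ => log_abs_div_nonneg x) tendsto_logPrimitive
  have hi : IntegrableOn (fun u : ℝ => log |(1 + u ^ 2) / (1 - u ^ 2)|) (Ioi 0) := by
    rw [← Ioc_union_Ioi_eq_Ioi zero_le_one]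
    exact hi1.union hi2
  rw [← ofReal_integral_eq_lintegral_ofReal hi (hnn _), ← Ioc_union_Ioi_eq_Ioi zero_le_one,
    setIntegral_union (Ioc_disjoint_Ioi le_rfl) measurableSet_Ioi hi1 hi2, hI1, hI2]
  congr 1
  simp [logPrimitive]

/-- In the coordinate tan the kernel is homogeneous of degree 0, so a scaling reduces both Schur
integrals to `lintegral_log_abs_div`. -/
theorem K_arctan (a b : ℝ) : K (arctan a) (arctan b) = log |(a + b) / (a - b)| := by
  have ha : (0 : ℝ) < √(1 + a ^ 2) := by positivity
  have hb : (0 : ℝ) < √(1 + b ^ 2) := by positivity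
  have h1 : sin (arctan a + arctan b) = (a + b) * (1 / (√(1 + a ^ 2) * √(1 + b ^ 2))) := by
    rw [sin_add, sin_arctan, sin_arctan, cos_arctan, cos_arctan]; field_simp
  have h2 : sin (arctan a - arctan b) = (a - b) * (1 / (√(1 + a ^ 2) * √(1 + b ^ 2))) := by
    rw [sin_sub, sin_arctan, sin_arctan, cos_arctan, cos_arctan]; field_simp
  rw [K, h1, h2, mul_div_mul_right _ _ (by positivity)]

theorem K_nonneg {s σ : ℝ} (hs : s ∈ Ioo 0 (π / 2)) (hσ : σ ∈ Ioo 0 (π / 2)) : 0 ≤ K s σ := by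
  rw [K]
  by_cases h : sin (s - σ) = 0
  · simp [h]
  · refine log_nonneg ?_
    have hss := sin_pos_of_pos_of_lt_pi hs.1 (by linarith [hs.2, pi_pos])
    have hsσ := sin_pos_of_pos_of_lt_pi hσ.1 (by linarith [hσ.2, pi_pos])
    have hcs := cos_pos_of_mem_Ioo ⟨by linarith [hs.1, pi_pos], hs.2⟩
    have hcσ := cos_pos_of_mem_Ioo ⟨by linarith [hσ.1, pi_pos], hσ.2⟩
    have p1 := mul_pos hss hcσ
    have p2 := mul_pos hcs hsσ
    rw [abs_div, one_le_div (abs_pos.2 h), sin_add, sin_sub,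
      abs_of_pos (by positivity : 0 < sin s * cos σ + cos s * sin σ), abs_le]
    constructor <;> linarith

theorem measurable_tan : Measurable tan := by
  have : tan = fun x => sin x / cos x := funext tan_eq_sin_div_cos
  rw [this]
  fun_prop

theorem measurable_K_left (σ : ℝ) : Measurable fun s => K s σ := by
  unfold K
  fun_prop

theorem image_arctan_eq {f : ℝ → ℝ} (hf : f '' Ioi 0 = Ioi 0) :
    (fun u => arctan (f u)) '' Ioi 0 = Ioo 0 (π / 2) := by
  rw [← image_image arctan f, hf]
  ext x
  constructor
  · rintro ⟨u, hu, rfl⟩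
    exact ⟨arctan_pos.2 hu, arctan_lt_pi_div_two u⟩
  · intro hx
    exact ⟨tan x, tan_pos_of_pos_of_lt_pi_div_two hx.1 hx.2,
      arctan_tan (by linarith [hx.1, pi_pos]) hx.2⟩

/-- Schur test for the kernel, first weight. -/
theorem lintegral_K_div_sqrt_tan_le {σ : ℝ} (hσ : σ ∈ Ioo 0 (π / 2)) :
    ∫⁻ s in Ioo 0 (π / 2), ENNReal.ofReal (K s σ / √(tan s)) ≤
      ENNReal.ofReal (2 * π * √(tan σ)) := by
  obtain ⟨y, hy, rfl⟩ : ∃ y, 0 < y ∧ arctan y = σ :=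
    ⟨tan σ, tan_pos_of_pos_of_lt_pi_div_two hσ.1 hσ.2,
      arctan_tan (by linarith [hσ.1, pi_pos]) hσ.2⟩
  -- Substitute tan s = y u²: the square absorbs the weight √(tan s), and the Jacobian factor 1/(1 +
  -- tan² s) is bounded by 1.
  have himg : (fun u : ℝ => y * u ^ 2) '' Ioi 0 = Ioi 0 := by
    ext x
    constructor
    · rintro ⟨u, hu, rfl⟩
      have : 0 < u := hu
      exact mul_pos hy (by positivity)
    · intro hx
      have hx' : 0 < x := hx
      refine ⟨√(x / y), sqrt_pos.2 (by positivity), ?_⟩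
      simp only
      rw [sq_sqrt (by positivity)]
      field_simp
  rw [← image_arctan_eq himg, lintegral_image_eq_lintegral_abs_deriv_mul measurableSet_Ioi
    (f' := fun u => 1 / (1 + (y * u ^ 2) ^ 2) * (y * (2 * u)))]
  · rw [tan_arctan]
    calc _ ≤ ∫⁻ u in Ioi 0, ENNReal.ofReal (2 * √y) *
          ENNReal.ofReal (log |(1 + u ^ 2) / (1 - u ^ 2)|) := by
          refine setLIntegral_mono' measurableSet_Ioi fun u hu => ?_
          have hu' : 0 < u := hu
          rw [← ENNReal.ofReal_mul (abs_nonneg _), ← ENNReal.ofReal_mul (by positivity)]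
          refine ENNReal.ofReal_le_ofReal ?_
          rw [K_arctan, tan_arctan, sqrt_mul hy.le, sqrt_sq hu'.le, abs_of_nonneg (by positivity)]
          have h1 : |(y * u ^ 2 + y) / (y * u ^ 2 - y)| = |(1 + u ^ 2) / (1 - u ^ 2)| := by
            rw [show y * u ^ 2 + y = y * (1 + u ^ 2) by ring,
              show y * u ^ 2 - y = -(y * (1 - u ^ 2)) by ring, div_neg, abs_neg,
              mul_div_mul_left _ _ hy.ne']
          rw [h1]
          have hL := log_abs_div_nonneg u
          set l := log |(1 + u ^ 2) / (1 - u ^ 2)|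
          have hsy : 0 < √y := sqrt_pos.2 hy
          have h2 : 1 / (1 + (y * u ^ 2) ^ 2) ≤ 1 := by
            rw [div_le_one (by positivity)]; nlinarith [sq_nonneg (y * u ^ 2)]
          calc 1 / (1 + (y * u ^ 2) ^ 2) * (y * (2 * u)) * (l / (√y * u))
              ≤ 1 * (y * (2 * u)) * (l / (√y * u)) := by gcongr
            _ = 2 * (√y * √y) * l / √y := by rw [mul_self_sqrt hy.le]; field_simp
            _ = 2 * √y * l := by field_simp
      _ = _ := by
          rw [lintegral_const_mul' _ _ ENNReal.ofReal_ne_top, lintegral_log_abs_div,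
            ← ENNReal.ofReal_mul (by positivity)]
          congr 1; ring
  · intro u _
    have := (((hasDerivAt_id u).pow 2).const_mul y).arctan
    refine (this.congr_deriv ?_).hasDerivWithinAt
    simp
  · intro u hu v hv huv
    have hu' : 0 < u := hu
    have hv' : 0 < v := hv
    have h := mul_left_cancel₀ hy.ne' (arctan_injective huv)
    exact (sq_eq_sq₀ hu'.le hv'.le).1 h

/-- Schur test for the kernel, second weight. -/
theorem lintegral_K_div_tan_mul_sqrt_tan_le {s : ℝ} (hs : s ∈ Ioo 0 (π / 2)) :
    ∫⁻ σ in Ioo 0 (π / 2), ENNReal.ofReal (K s σ / (tan σ * √(tan σ))) ≤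
      ENNReal.ofReal (2 * π / √(tan s)) := by
  obtain ⟨x, hx, rfl⟩ : ∃ x, 0 < x ∧ arctan x = s :=
    ⟨tan s, tan_pos_of_pos_of_lt_pi_div_two hs.1 hs.2,
      arctan_tan (by linarith [hs.1, pi_pos]) hs.2⟩
  -- Here tan σ = x/u²; the reciprocal power cancels the weight (tan σ)^(−3/2) against the Jacobian.
  have himg : (fun u : ℝ => x / u ^ 2) '' Ioi 0 = Ioi 0 := by
    ext t
    constructor
    · rintro ⟨u, hu, rfl⟩
      have : 0 < u := hu
      exact div_pos hx (by positivity)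
    · intro ht
      have ht' : 0 < t := ht
      refine ⟨√(x / t), sqrt_pos.2 (by positivity), ?_⟩
      simp only
      rw [sq_sqrt (by positivity)]
      field_simp
  rw [← image_arctan_eq himg, lintegral_image_eq_lintegral_abs_deriv_mul measurableSet_Ioi
    (f' := fun u => 1 / (1 + (x / u ^ 2) ^ 2) * (-(2 * x) / u ^ 3))]
  · rw [tan_arctan]
    calc _ ≤ ∫⁻ u in Ioi 0, ENNReal.ofReal (2 / √x) *
          ENNReal.ofReal (log |(1 + u ^ 2) / (1 - u ^ 2)|) := by
          refine setLIntegral_mono' measurableSet_Ioi fun u hu => ?_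
          have hu' : 0 < u := hu
          rw [← ENNReal.ofReal_mul (abs_nonneg _), ← ENNReal.ofReal_mul (by positivity)]
          refine ENNReal.ofReal_le_ofReal ?_
          rw [K_arctan, tan_arctan, sqrt_div hx.le, sqrt_sq hu'.le, abs_mul, neg_div, abs_neg,
            abs_of_nonneg (by positivity), abs_of_nonneg (by positivity)]
          have h1 : |(x + x / u ^ 2) / (x - x / u ^ 2)| = |(1 + u ^ 2) / (1 - u ^ 2)| := by
            rw [show x + x / u ^ 2 = (x / u ^ 2) * (1 + u ^ 2) by field_simp; ring,
              show x - x / u ^ 2 = -((x / u ^ 2) * (1 - u ^ 2)) by field_simp; ring, div_neg, abs_neg,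
              mul_div_mul_left _ _ (by positivity)]
          rw [h1]
          have hL := log_abs_div_nonneg u
          set l := log |(1 + u ^ 2) / (1 - u ^ 2)|
          have hsx : 0 < √x := sqrt_pos.2 hx
          have h2 : 1 / (1 + (x / u ^ 2) ^ 2) ≤ 1 := by
            rw [div_le_one (by positivity)]; nlinarith [sq_nonneg (x / u ^ 2)]
          calc 1 / (1 + (x / u ^ 2) ^ 2) * (2 * x / u ^ 3) * (l / (x / u ^ 2 * (√x / u)))
              ≤ 1 * (2 * x / u ^ 3) * (l / (x / u ^ 2 * (√x / u))) := by gcongr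
            _ = 2 / √x * l := by field_simp
      _ = _ := by
          rw [lintegral_const_mul' _ _ ENNReal.ofReal_ne_top, lintegral_log_abs_div,
            ← ENNReal.ofReal_mul (by positivity)]
          congr 1; ring
  · intro u hu
    have hu' : u ≠ 0 := ne_of_gt hu
    have := (((hasDerivAt_const u x).div ((hasDerivAt_id u).pow 2) (pow_ne_zero 2 hu'))).arctan
    refine (this.congr_deriv ?_).hasDerivWithinAt
    simp
    left
    field_simp
  · intro u hu v hv huv
    have hu' : 0 < u := hu
    have hv' : 0 < v := hv
    have h := arctan_injective huv
    rw [div_eq_div_iff (by positivity) (by positivity)] at h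
    exact ((sq_eq_sq₀ hv'.le hu'.le).1 (mul_left_cancel₀ hx.ne' h)).symm

theorem lintegral_mul_sq_le {X : Type*} [MeasurableSpace X] {μ : Measure X} {f g : X → ENNReal}
    (hf : AEMeasurable f μ) (hg : AEMeasurable g μ) :
    (∫⁻ x, f x * g x ∂μ) ^ 2 ≤ (∫⁻ x, f x ^ 2 ∂μ) * ∫⁻ x, g x ^ 2 ∂μ := by
  have h := ENNReal.lintegral_mul_le_Lp_mul_Lq μ Real.HolderConjugate.two_two hf hg
  have h2 := pow_le_pow_left₀ zero_le h 2
  rw [mul_pow] at h2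
  simp only [← ENNReal.rpow_natCast, ← ENNReal.rpow_mul] at h2 ⊢
  norm_num at h2 ⊢
  exact h2

theorem enorm_H_le {ζ : ℝ → ℝ} (σ : ℝ) :
    ‖H ζ σ‖ₑ ≤ ENNReal.ofReal (1 / π) * ∫⁻ s in Ioo 0 (π / 2), ‖K s σ * ζ s‖ₑ := by
  have hpi : (0 : ℝ) ≤ π / 2 := by positivity
  rw [H, enorm_mul, intervalIntegral.integral_of_le hpi, integral_Ioc_eq_integral_Ioo,
    Real.enorm_of_nonneg (by positivity : (0 : ℝ) ≤ 1 / π)]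
  gcongr
  exact enorm_integral_le_lintegral_enorm _

theorem cot_eq_inv_tan (σ : ℝ) : cot σ = (tan σ)⁻¹ := (tan_inv_eq_cot σ).symm

/-- **Hardy's inequality** for the operator `H`. -/
theorem lintegral_enorm_cot_mul_H_sq_le {ζ : ℝ → ℝ} (hζ : Measurable ζ) :
    ∫⁻ σ in Ioo 0 (π / 2), ‖cot σ * H ζ σ‖ₑ ^ 2 ≤ 4 * ∫⁻ s in Ioo 0 (π / 2), ‖ζ s‖ₑ ^ 2 := by
  have hKs : ∀ σ, Measurable fun s => K s σ := fun σ => measurable_K_left σ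
  have hcs : ∀ σ ∈ Ioo 0 (π / 2), ‖H ζ σ‖ₑ ^ 2 ≤ ENNReal.ofReal (1 / π) ^ 2 *
      (ENNReal.ofReal (2 * π * √(tan σ)) *
        ∫⁻ s in Ioo 0 (π / 2), ENNReal.ofReal (K s σ * √(tan s)) * ‖ζ s‖ₑ ^ 2) := by
    intro σ hσ
    refine (pow_le_pow_left₀ zero_le (enorm_H_le σ) 2).trans ?_
    rw [mul_pow]
    gcongr
    -- Cauchy–Schwarz with K split as (K/√tan)^{1/2} · (K√tan)^{1/2}; the first weight test bounds
    -- the first factor.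
    have hpt : ∀ s ∈ Ioo 0 (π / 2), ‖K s σ * ζ s‖ₑ = ENNReal.ofReal √(K s σ / √(tan s)) *
        (ENNReal.ofReal √(K s σ * √(tan s)) * ‖ζ s‖ₑ) := by
      intro s hs
      have ht := tan_pos_of_pos_of_lt_pi_div_two hs.1 hs.2
      have hst : 0 < √(tan s) := sqrt_pos.2 ht
      have hK := K_nonneg hs hσ
      rw [enorm_mul, Real.enorm_of_nonneg hK, ← mul_assoc,
        ← ENNReal.ofReal_mul (sqrt_nonneg _), ← sqrt_mul (by positivity)]
      congr 2
      rw [show K s σ / √(tan s) * (K s σ * √(tan s)) = K s σ ^ 2 by field_simp, sqrt_sq hK]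
    rw [setLIntegral_congr_fun measurableSet_Ioo hpt]
    refine (lintegral_mul_sq_le (Measurable.aemeasurable ?_) (Measurable.aemeasurable ?_)).trans ?_
    · have := hKs σ; have := measurable_tan; fun_prop
    · have := hKs σ; have := measurable_tan; fun_prop
    · refine mul_le_mul' ?_ ?_
      · refine le_trans (le_of_eq ?_) (lintegral_K_div_sqrt_tan_le hσ)
        refine setLIntegral_congr_fun measurableSet_Ioo fun s hs => ?_
        have hK := K_nonneg hs hσ
        rw [← ENNReal.ofReal_pow (sqrt_nonneg _), sq_sqrt (by positivity)]
      · refine le_of_eq (setLIntegral_congr_fun measurableSet_Ioo fun s hs => ?_)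
        have hK := K_nonneg hs hσ
        rw [mul_pow, ← ENNReal.ofReal_pow (sqrt_nonneg _), sq_sqrt (by positivity)]
  calc ∫⁻ σ in Ioo 0 (π / 2), ‖cot σ * H ζ σ‖ₑ ^ 2
      ≤ ∫⁻ σ in Ioo 0 (π / 2), ∫⁻ s in Ioo 0 (π / 2), ENNReal.ofReal (2 / π) *
          (ENNReal.ofReal (√(tan s)) * ‖ζ s‖ₑ ^ 2 *
            ENNReal.ofReal (K s σ / (tan σ * √(tan σ)))) := by
        refine setLIntegral_mono' measurableSet_Ioo fun σ hσ => ?_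
        have ht := tan_pos_of_pos_of_lt_pi_div_two hσ.1 hσ.2
        have hst : 0 < √(tan σ) := sqrt_pos.2 ht
        rw [enorm_mul, mul_pow]
        refine (mul_le_mul_right (hcs σ hσ) _).trans (le_of_eq ?_)
        rw [← mul_assoc, ← mul_assoc, cot_eq_inv_tan, Real.enorm_of_nonneg (by positivity),
          ← ENNReal.ofReal_pow (by positivity), ← ENNReal.ofReal_pow (by positivity),
          ← ENNReal.ofReal_mul (by positivity), ← ENNReal.ofReal_mul (by positivity),
          ← lintegral_const_mul' _ _ ENNReal.ofReal_ne_top]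
        refine setLIntegral_congr_fun measurableSet_Ioo fun s hs => ?_
        have hK := K_nonneg hs hσ
        rw [mul_comm (ENNReal.ofReal √(tan s)), mul_assoc (‖ζ s‖ₑ ^ 2),
          ← ENNReal.ofReal_mul (sqrt_nonneg _), mul_left_comm (ENNReal.ofReal (2 / π)),
          ← ENNReal.ofReal_mul (by positivity), ← mul_assoc, ← ENNReal.ofReal_mul (by positivity),
          mul_comm]
        congr 2
        have h2 : tan σ = √(tan σ) * √(tan σ) := (mul_self_sqrt ht.le).symm
        set q := √(tan σ)
        rw [h2]
        field_simp
    -- Tonelli brings the σ-integral inside for the second weight test; the constant is (2/π) · 2π =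
    -- 4.
    _ = ∫⁻ s in Ioo 0 (π / 2), ∫⁻ σ in Ioo 0 (π / 2), ENNReal.ofReal (2 / π) *
          (ENNReal.ofReal (√(tan s)) * ‖ζ s‖ₑ ^ 2 *
            ENNReal.ofReal (K s σ / (tan σ * √(tan σ)))) := by
        refine lintegral_lintegral_swap (Measurable.aemeasurable ?_)
        have h1 : Measurable fun p : ℝ × ℝ => K p.2 p.1 := by
          unfold K
          fun_prop
        have := measurable_tan
        simp only [Function.uncurry_def]
        fun_prop
    _ ≤ ∫⁻ s in Ioo 0 (π / 2), 4 * ‖ζ s‖ₑ ^ 2 := by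
        refine setLIntegral_mono' measurableSet_Ioo fun s hs => ?_
        have ht := tan_pos_of_pos_of_lt_pi_div_two hs.1 hs.2
        have hst : 0 < √(tan s) := sqrt_pos.2 ht
        rw [lintegral_const_mul' _ _ ENNReal.ofReal_ne_top, lintegral_const_mul' _ _ (by finiteness)]
        calc _ ≤ ENNReal.ofReal (2 / π) * (ENNReal.ofReal √(tan s) * ‖ζ s‖ₑ ^ 2 *
              ENNReal.ofReal (2 * π / √(tan s))) := by
              gcongr
              exact lintegral_K_div_tan_mul_sqrt_tan_le hs
          _ = ENNReal.ofReal (2 / π * √(tan s) * (2 * π / √(tan s))) * ‖ζ s‖ₑ ^ 2 := by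
              rw [ENNReal.ofReal_mul (by positivity), ENNReal.ofReal_mul (by positivity)]
              ring
          _ = _ := by
              congr 1
              rw [show 2 / π * √(tan s) * (2 * π / √(tan s)) = 4 by field_simp; norm_num]
              simp
    _ = _ := lintegral_const_mul' _ _ (by finiteness)

end Hardy
-- The invariant ball and pointwise bounds for Φ
section Estimates

/-- Lebesgue measure on `(0, π/2)`. -/
abbrev quarter : Measure ℝ := volume.restrict (Ioo (0 : ℝ) (π / 2))

theorem eLpNorm_two_sq {X : Type*} [MeasurableSpace X] {μ : Measure X} (f : X → ℝ) :
    eLpNorm f 2 μ ^ 2 = ∫⁻ x, ‖f x‖ₑ ^ 2 ∂μ := by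
  have h := eLpNorm_nnreal_pow_eq_lintegral (f := f) (μ := μ) (p := 2) two_ne_zero
  rw [show ((2 : NNReal) : ℝ) = ((2 : ℕ) : ℝ) by norm_num] at h
  simpa only [ENNReal.rpow_natCast, ENNReal.coe_ofNat] using h

theorem eLpNorm_two_le_iff {X : Type*} [MeasurableSpace X] {μ : Measure X} {f : X → ℝ} {C : ℝ}
    (hC : 0 ≤ C) : eLpNorm f 2 μ ≤ ENNReal.ofReal C ↔
      ∫⁻ x, ‖f x‖ₑ ^ 2 ∂μ ≤ ENNReal.ofReal (C ^ 2) := by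
  rw [← eLpNorm_two_sq, ENNReal.ofReal_pow hC]
  exact (ENNReal.pow_right_strictMono two_ne_zero).le_iff_le.symm

theorem eLpNorm_coe_L2 (ζ : L2) : eLpNorm ζ 2 quarter = ENNReal.ofReal ‖ζ‖ := by
  rw [Lp.norm_def, ENNReal.ofReal_toReal (Lp.eLpNorm_ne_top ζ)]

theorem lintegral_enorm_sq_L2 (ζ : L2) :
    ∫⁻ s in Ioo 0 (π / 2), ‖ζ s‖ₑ ^ 2 = ENNReal.ofReal (‖ζ‖ ^ 2) := by
  rw [← eLpNorm_two_sq, eLpNorm_coe_L2, ENNReal.ofReal_pow (norm_nonneg _)]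

theorem measurable_coe_L2 (ζ : L2) : Measurable ζ := (Lp.stronglyMeasurable ζ).measurable

theorem integrable_coe_L2 (ζ : L2) : Integrable ζ quarter :=
  (Lp.memLp ζ).integrable (by norm_num)

theorem eLpNorm_K_le {σ : ℝ} (hσ : σ ∈ Ioo 0 (π / 2)) :
    eLpNorm (fun s => K s σ) 2 quarter ≤ ENNReal.ofReal √(π * (σ * (π - 2 * σ))) := by
  have h : 0 ≤ π * (σ * (π - 2 * σ)) :=
    mul_nonneg pi_pos.le (mul_nonneg hσ.1.le (by linarith [hσ.2]))
  rw [eLpNorm_two_le_iff (sqrt_nonneg _), sq_sqrt h]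
  exact lintegral_enorm_K_sq_le hσ

theorem memLp_K {σ : ℝ} (hσ : σ ∈ Ioo 0 (π / 2)) : MemLp (fun s => K s σ) 2 quarter :=
  ⟨(measurable_K_left σ).aestronglyMeasurable, (eLpNorm_K_le hσ).trans_lt ENNReal.ofReal_lt_top⟩

theorem H_eq_inner (ζ : L2) {σ : ℝ} (hσ : σ ∈ Ioo 0 (π / 2)) :
    H ζ σ = 1 / π * inner ℝ ((memLp_K hσ).toLp _ : L2) ζ := by
  have hpi : (0 : ℝ) ≤ π / 2 := by positivity
  rw [H, intervalIntegral.integral_of_le hpi, integral_Ioc_eq_integral_Ioo, L2.inner_def]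
  congr 1
  refine integral_congr_ae ?_
  filter_upwards [(memLp_K hσ).coeFn_toLp] with s hs
  rw [hs]
  simp [mul_comm]

theorem abs_H_le (ζ : L2) {σ : ℝ} (hσ : σ ∈ Ioo 0 (π / 2)) :
    |H ζ σ| ≤ √(σ * (π - 2 * σ) / π) * ‖ζ‖ := by
  have h0 : 0 ≤ σ * (π - 2 * σ) := mul_nonneg hσ.1.le (by linarith [hσ.2])
  rw [H_eq_inner ζ hσ, abs_mul, abs_of_pos (by positivity)]
  have h1 : ‖((memLp_K hσ).toLp _ : L2)‖ ≤ √(π * (σ * (π - 2 * σ))) := by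
    rw [Lp.norm_toLp]
    exact ENNReal.toReal_le_of_le_ofReal (sqrt_nonneg _) (eLpNorm_K_le hσ)
  calc 1 / π * |inner ℝ ((memLp_K hσ).toLp _ : L2) ζ|
      ≤ 1 / π * (√(π * (σ * (π - 2 * σ))) * ‖ζ‖) := by
        gcongr
        exact (abs_real_inner_le_norm _ _).trans (by gcongr)
    _ = √(σ * (π - 2 * σ) / π) * ‖ζ‖ := by
        rw [← mul_assoc]
        congr 1
        rw [show σ * (π - 2 * σ) / π = π * (σ * (π - 2 * σ)) / π ^ 2 by field_simp,
          sqrt_div (by positivity), sqrt_sq pi_pos.le]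
        ring

theorem abs_H_le_sqrt (ζ : L2) {σ : ℝ} (hσ : σ ∈ Ioo 0 (π / 2)) : |H ζ σ| ≤ √σ * ‖ζ‖ := by
  refine (abs_H_le ζ hσ).trans ?_
  gcongr
  rw [div_le_iff₀ pi_pos]
  nlinarith [hσ.1]

theorem H_nonneg {ζ : L2} (hζ : 0 ≤ ζ) {σ : ℝ} (hσ : σ ∈ Ioo 0 (π / 2)) : 0 ≤ H ζ σ := by
  have hpi : (0 : ℝ) ≤ π / 2 := by positivity
  rw [H, intervalIntegral.integral_of_le hpi, integral_Ioc_eq_integral_Ioo]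
  refine mul_nonneg (by positivity) (integral_nonneg_of_ae ?_)
  filter_upwards [(Lp.coeFn_nonneg ζ).2 hζ, ae_restrict_mem measurableSet_Ioo] with s h1 h2
  exact mul_nonneg (K_nonneg h2 hσ) h1

/-- The radius of the invariant ball. -/
def radius : ℝ := 9 * √π / 2

theorem radius_pos : 0 < radius := by unfold radius; positivity

theorem angle_mem_Icc {ζ : L2} (hζ : 0 ≤ ζ) (hn : ‖ζ‖ ≤ radius) {σ : ℝ} (hσ : σ ∈ Ioo 0 (π / 2)) :
    σ + 1 / 3 * H ζ σ ∈ Icc 0 π := by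
  have h0 : 0 ≤ σ * (π - 2 * σ) := mul_nonneg hσ.1.le (by linarith [hσ.2])
  have hH := H_nonneg hζ hσ
  have h1 := abs_H_le ζ hσ
  rw [abs_of_nonneg hH] at h1
  refine ⟨by linarith [hσ.1], ?_⟩
  have h2 : H ζ σ ^ 2 ≤ (3 * (π - σ)) ^ 2 := by
    calc H ζ σ ^ 2 ≤ (√(σ * (π - 2 * σ) / π) * radius) ^ 2 := by
          gcongr
          exact h1.trans (by gcongr)
      _ = 81 / 4 * (σ * (π - 2 * σ)) := by
          rw [radius, mul_pow, sq_sqrt (by positivity), div_pow, mul_pow, sq_sqrt pi_pos.le]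
          field_simp
          ring
      -- The claim is 22σ² − 17πσ + 4π² ≥ 0; 88 times the left side is (44σ − 17π)² + 63π².
      _ ≤ _ := by nlinarith [sq_nonneg (44 * σ - 17 * π), sq_nonneg π]
  have h3 : H ζ σ ≤ 3 * (π - σ) :=
    (le_abs_self _).trans (abs_le_of_sq_le_sq h2 (by linarith [hσ.2, pi_pos]))
  linarith

theorem mul_cos_le_sin {x : ℝ} (hx : x ∈ Icc 0 (π / 2)) : x * cos x ≤ sin x := by
  rcases eq_or_lt_of_le hx.1 with rfl | h0
  · simp
  rcases eq_or_lt_of_le hx.2 with rfl | h1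
  · simp
  have hc : 0 < cos x := cos_pos_of_mem_Ioo ⟨by linarith, h1⟩
  have := lt_tan h0 h1
  rw [tan_eq_sin_div_cos, lt_div_iff₀ hc] at this
  exact this.le

/-- The difference vanishes at 0 and has derivative (x/3)(sin x − x cos x) ≥ 0. The weaker bound σ
cot σ ≤ 1 would only give norm √(π/2) > 1. -/
theorem mul_cos_le {x : ℝ} (hx : x ∈ Icc 0 (π / 2)) : x * cos x ≤ (1 - x ^ 2 / 3) * sin x := by
  let g : ℝ → ℝ := fun x => (1 - x ^ 2 / 3) * sin x - x * cos x
  have hd : ∀ x, HasDerivAt g (x / 3 * (sin x - x * cos x)) x := by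
    intro x
    have h1 := ((((hasDerivAt_id x).pow 2).div_const 3).const_sub 1).mul (hasDerivAt_sin x)
    have h2 := (hasDerivAt_id x).mul (hasDerivAt_cos x)
    convert! h1.sub h2 using 1
    simp
    ring
  have hmono : MonotoneOn g (Icc 0 (π / 2)) := by
    refine monotoneOn_of_deriv_nonneg (convex_Icc _ _)
      (fun x _ => (hd x).continuousAt.continuousWithinAt)
      (fun x _ => (hd x).differentiableAt.differentiableWithinAt) fun x hx => ?_
    rw [interior_Icc] at hx
    rw [(hd x).deriv]
    exact mul_nonneg (by linarith [hx.1])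
      (sub_nonneg.2 (mul_cos_le_sin (Ioo_subset_Icc_self hx)))
  have := hmono (left_mem_Icc.2 (by positivity)) hx hx.1
  simp only [g] at this
  simp at this
  exact this

theorem cot_pos_of_mem {σ : ℝ} (hσ : σ ∈ Ioo 0 (π / 2)) : 0 < cot σ := by
  rw [cot_eq_inv_tan]
  exact inv_pos.2 (tan_pos_of_pos_of_lt_pi_div_two hσ.1 hσ.2)

theorem measurable_cot : Measurable cot := by
  have : cot = fun x => (tan x)⁻¹ := funext cot_eq_inv_tan
  rw [this]
  exact measurable_tan.inv

theorem mul_cot_le {σ : ℝ} (hσ : σ ∈ Ioo 0 (π / 2)) : σ * cot σ ≤ 1 - σ ^ 2 / 3 := by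
  have hs := sin_pos_of_pos_of_lt_pi hσ.1 (by linarith [hσ.2, pi_pos])
  rw [cot_eq_cos_div_sin, ← mul_div_assoc, div_le_iff₀ hs]
  exact mul_cos_le (Ioo_subset_Icc_self hσ)

theorem eLpNorm_mul_cot_le : eLpNorm (fun σ => σ * cot σ) 2 quarter ≤ ENNReal.ofReal 1 := by
  rw [eLpNorm_two_le_iff zero_le_one]
  have hpi : (0 : ℝ) ≤ π / 2 := by positivity
  have hc : Continuous fun σ : ℝ => (1 - σ ^ 2 / 3) ^ 2 := by fun_prop
  calc ∫⁻ σ in Ioo 0 (π / 2), ‖σ * cot σ‖ₑ ^ 2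
      ≤ ∫⁻ σ in Ioo 0 (π / 2), ENNReal.ofReal ((1 - σ ^ 2 / 3) ^ 2) := by
        refine setLIntegral_mono' measurableSet_Ioo fun σ hσ => ?_
        have h1 : 0 ≤ σ * cot σ := mul_nonneg hσ.1.le (cot_pos_of_mem hσ).le
        rw [Real.enorm_of_nonneg h1, ← ENNReal.ofReal_pow h1]
        exact ENNReal.ofReal_le_ofReal (pow_le_pow_left₀ h1 (mul_cot_le hσ) 2)
    _ = ENNReal.ofReal (∫ σ in Ioo 0 (π / 2), (1 - σ ^ 2 / 3) ^ 2) := by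
        rw [ofReal_integral_eq_lintegral_ofReal]
        · exact hc.integrableOn_Icc.mono_set Ioo_subset_Icc_self
        · exact Eventually.of_forall fun σ => sq_nonneg _
    _ ≤ _ := by
        refine ENNReal.ofReal_le_ofReal ?_
        rw [← integral_Ioc_eq_integral_Ioo, ← intervalIntegral.integral_of_le hpi]
        have hd : ∀ x ∈ uIcc 0 (π / 2), HasDerivAt (fun x : ℝ => x - 2 / 9 * x ^ 3 + 1 / 45 * x ^ 5)
            ((1 - x ^ 2 / 3) ^ 2) x := by
          intro x _
          have := ((hasDerivAt_id x).sub (((hasDerivAt_id x).pow 3).const_mul (2 / 9))).add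
            (((hasDerivAt_id x).pow 5).const_mul (1 / 45))
          convert! this using 1
          simp
          ring
        rw [intervalIntegral.integral_eq_sub_of_hasDerivAt hd (hc.intervalIntegrable _ _)]
        -- The integral is p − 2p³/9 + p⁵/45 with p = π/2, about 0.92, so two decimals of π suffice.
        have h1 : (1.57 : ℝ) ≤ π / 2 := by linarith [pi_gt_d2]
        have h2 : π / 2 ≤ 1.575 := by linarith [pi_lt_d2]
        have h3 : (1.57 : ℝ) ^ 3 ≤ (π / 2) ^ 3 := by gcongr
        have h5 : (π / 2) ^ 5 ≤ 1.575 ^ 5 := by gcongr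
        norm_num at h3 h5 ⊢
        linarith

theorem measurable_H (ζ : L2) : Measurable (H ζ) := by
  have h : StronglyMeasurable fun σ => ∫ s in (0 : ℝ)..(π / 2), K s σ * ζ s := by
    have hpi : (0 : ℝ) ≤ π / 2 := by positivity
    simp_rw [intervalIntegral.integral_of_le hpi]
    refine StronglyMeasurable.integral_prod_right' (f := fun p : ℝ × ℝ => K p.2 p.1 * ζ p.2) ?_
    have := measurable_coe_L2 ζ
    refine Measurable.stronglyMeasurable ?_
    unfold K
    fun_prop
  exact h.measurable.const_mul _

theorem eLpNorm_cot_mul_H_le (ζ : L2) :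
    eLpNorm (fun σ => cot σ * H ζ σ) 2 quarter ≤ ENNReal.ofReal (2 * ‖ζ‖) := by
  rw [eLpNorm_two_le_iff (by positivity)]
  refine (lintegral_enorm_cot_mul_H_sq_le (measurable_coe_L2 ζ)).trans (le_of_eq ?_)
  rw [lintegral_enorm_sq_L2, mul_pow, ENNReal.ofReal_mul (by norm_num)]
  norm_num

theorem aemeasurable_primitive (ζ : L2) :
    AEMeasurable (fun σ => ∫ s in (0 : ℝ)..σ, ζ s) quarter := by
  have hpi : (0 : ℝ) ≤ π / 2 := by positivity
  have h : ContinuousOn (fun σ => ∫ s in (0 : ℝ)..σ, ζ s) (uIcc 0 (π / 2)) := by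
    refine intervalIntegral.continuousOn_primitive_interval ?_
    rw [uIcc_of_le hpi, integrableOn_Icc_iff_integrableOn_Ioo]
    exact integrable_coe_L2 ζ
  rw [uIcc_of_le hpi] at h
  exact (h.mono Ioo_subset_Icc_self).aemeasurable measurableSet_Ioo

theorem aemeasurable_Phi (α : ℝ) (ζ : L2) : AEMeasurable (Phi α ζ) quarter := by
  have h1 := (measurable_H ζ).aemeasurable (μ := quarter)
  have h2 := aemeasurable_primitive ζ
  have h3 := measurable_cot.aemeasurable (μ := quarter)
  unfold Phi
  fun_prop

variable {α : ℝ} {ζ : L2}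

theorem primitive_nonneg (hζ : 0 ≤ ζ) {σ : ℝ} (hσ : σ ∈ Ioo 0 (π / 2)) :
    0 ≤ ∫ s in (0 : ℝ)..σ, ζ s := by
  rw [intervalIntegral.integral_of_le hσ.1.le]
  refine integral_nonneg_of_ae ?_
  have hsub : Ioc 0 σ ⊆ Ioo 0 (π / 2) := fun x hx => ⟨hx.1, hx.2.trans_lt hσ.2⟩
  exact ae_restrict_of_ae_restrict_of_subset hsub ((Lp.coeFn_nonneg ζ).2 hζ)

theorem Phi_nonneg (hα : 0 < α) (hζ : 0 ≤ ζ) (hn : ‖ζ‖ ≤ radius) {σ : ℝ}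
    (hσ : σ ∈ Ioo 0 (π / 2)) : 0 ≤ Phi α ζ σ := by
  have h := angle_mem_Icc hζ hn hσ
  have h1 := sin_nonneg_of_nonneg_of_le_pi h.1 h.2
  have h2 := (cot_pos_of_mem hσ).le
  unfold Phi
  positivity

theorem Phi_le (hα : 0 < α) (hζ : 0 ≤ ζ) (hn : ‖ζ‖ ≤ radius) {σ : ℝ}
    (hσ : σ ∈ Ioo 0 (π / 2)) :
    Phi α ζ σ ≤ 3 / (α * π) * (σ * cot σ) + 1 / (α * π) * (cot σ * H ζ σ) := by
  have h := angle_mem_Icc hζ hn hσ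
  have h1 := sin_nonneg_of_nonneg_of_le_pi h.1 h.2
  have h2 := (cot_pos_of_mem hσ).le
  have h3 := sin_le h.1
  have h4 : 1 ≤ exp (∫ s in (0 : ℝ)..σ, ζ s) := one_le_exp (primitive_nonneg hζ hσ)
  calc Phi α ζ σ ≤ 3 / (α * π) * (sin (σ + 1 / 3 * H ζ σ) * cot σ) := by
        unfold Phi
        gcongr
        exact div_le_self (by positivity) h4
    _ ≤ 3 / (α * π) * ((σ + 1 / 3 * H ζ σ) * cot σ) := by gcongr
    _ = _ := by ring

theorem eLpNorm_Phi_le (hα : 2 / π * (1 + 1 / (3 * √π)) ≤ α) (hζ : 0 ≤ ζ) (hn : ‖ζ‖ ≤ radius) :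
    eLpNorm (Phi α ζ) 2 quarter ≤ ENNReal.ofReal radius := by
  have hα0 : 0 < α := lt_of_lt_of_le (by positivity) hα
  have hb : ∀ᵐ σ ∂quarter, ‖Phi α ζ σ‖ ≤
      (((3 / (α * π)) • fun σ => σ * cot σ) + (1 / (α * π)) • fun σ => cot σ * H ζ σ) σ := by
    filter_upwards [ae_restrict_mem measurableSet_Ioo] with σ hσ
    rw [Real.norm_of_nonneg (Phi_nonneg hα0 hζ hn hσ)]
    exact Phi_le hα0 hζ hn hσ
  have hm1 : AEStronglyMeasurable ((3 / (α * π)) • fun σ => σ * cot σ) quarter :=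
    ((measurable_id.mul measurable_cot).const_smul _).aestronglyMeasurable
  have hm2 : AEStronglyMeasurable ((1 / (α * π)) • fun σ => cot σ * H ζ σ) quarter :=
    ((measurable_cot.mul (measurable_H ζ)).const_smul _).aestronglyMeasurable
  refine (eLpNorm_mono_ae_real hb).trans ((eLpNorm_add_le hm1 hm2 one_le_two).trans ?_)
  rw [eLpNorm_const_smul, eLpNorm_const_smul, Real.enorm_of_nonneg (by positivity),
    Real.enorm_of_nonneg (by positivity)]
  calc _ ≤ ENNReal.ofReal (3 / (α * π)) * ENNReal.ofReal 1 +
        ENNReal.ofReal (1 / (α * π)) * ENNReal.ofReal (2 * ‖ζ‖) := by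
        gcongr
        · exact eLpNorm_mul_cot_le
        · exact eLpNorm_cot_mul_H_le ζ
    _ = ENNReal.ofReal (3 / (α * π) * 1 + 1 / (α * π) * (2 * ‖ζ‖)) := by
        rw [ENNReal.ofReal_add (by positivity) (by positivity),
          ← ENNReal.ofReal_mul (by positivity), ← ENNReal.ofReal_mul (by positivity)]
    _ ≤ _ := by
        refine ENNReal.ofReal_le_ofReal ?_
        calc 3 / (α * π) * 1 + 1 / (α * π) * (2 * ‖ζ‖)
            ≤ 3 / (α * π) * 1 + 1 / (α * π) * (2 * radius) := by gcongr
          _ = (3 + 2 * radius) / (α * π) := by ring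
          _ ≤ radius := by
            rw [div_le_iff₀ (by positivity)]
            have hs : 0 < √π := sqrt_pos.2 pi_pos
            have h1 : 2 * (1 + 1 / (3 * √π)) ≤ α * π := by
              have := mul_le_mul_of_nonneg_right hα pi_pos.le
              rwa [show 2 / π * (1 + 1 / (3 * √π)) * π = 2 * (1 + 1 / (3 * √π)) by field_simp] at this
            -- This identity ties the threshold for α to the radius.
            calc 3 + 2 * radius = radius * (2 * (1 + 1 / (3 * √π))) := by
                  unfold radius; field_simp; ring
              _ ≤ _ := by have := radius_pos; gcongr

theorem memLp_Phi (hα : 2 / π * (1 + 1 / (3 * √π)) ≤ α) (hζ : 0 ≤ ζ) (hn : ‖ζ‖ ≤ radius) :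
    MemLp (Phi α ζ) 2 quarter :=
  ⟨(aemeasurable_Phi α ζ).aestronglyMeasurable,
    (eLpNorm_Phi_le hα hζ hn).trans_lt ENNReal.ofReal_lt_top⟩

/-- Near 0, cot σ ≤ 1/σ while Hζ is at most R√σ. The result is an integrable majorant uniform over
the invariant set. -/
theorem Phi_le_rpow (hα : 0 < α) (hζ : 0 ≤ ζ) (hn : ‖ζ‖ ≤ radius) {σ : ℝ}
    (hσ : σ ∈ Ioo 0 (π / 2)) :
    Phi α ζ σ ≤ (6 / (α * π) + radius / (α * π)) * σ ^ (-(1 / 2) : ℝ) := by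
  have hs : 0 < √σ := sqrt_pos.2 hσ.1
  have hrp : σ ^ (-(1 / 2) : ℝ) = 1 / √σ := by
    rw [rpow_neg hσ.1.le, ← sqrt_eq_rpow, one_div]
  have hσ1 : √σ ≤ 2 := by
    rw [sqrt_le_left (by norm_num)]
    linarith [hσ.2, pi_lt_d2]
  have hc : cot σ ≤ 1 / σ := by
    rw [le_div_iff₀ hσ.1, mul_comm]
    exact (mul_cot_le hσ).trans (by nlinarith [hσ.1])
  have hc0 := (cot_pos_of_mem hσ).le
  have hH := abs_H_le_sqrt ζ hσ
  have hH0 := H_nonneg hζ hσ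
  rw [abs_of_nonneg hH0] at hH
  refine (Phi_le hα hζ hn hσ).trans ?_
  have h1 : σ * cot σ ≤ 2 * (1 / √σ) := by
    refine (mul_cot_le hσ).trans ?_
    rw [mul_one_div, le_div_iff₀ hs]
    nlinarith [sq_nonneg σ]
  have h2 : cot σ * H ζ σ ≤ radius * (1 / √σ) := by
    calc cot σ * H ζ σ ≤ 1 / σ * (√σ * radius) := by
          gcongr
          · exact one_div_nonneg.2 hσ.1.le
          · exact hH.trans (by gcongr)
      _ = 1 / (√σ * √σ) * (√σ * radius) := by rw [mul_self_sqrt hσ.1.le]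
      _ = _ := by field_simp
  rw [hrp]
  calc _ ≤ 3 / (α * π) * (2 * (1 / √σ)) + 1 / (α * π) * (radius * (1 / √σ)) := by gcongr
    _ = _ := by ring

theorem integrable_rpow_quarter : Integrable (fun σ : ℝ => σ ^ (-(1 / 2) : ℝ)) quarter := by
  have h := intervalIntegral.intervalIntegrable_rpow' (a := 0) (b := π / 2) (r := -(1 / 2))
    (by norm_num)
  rw [intervalIntegrable_iff_integrableOn_Ioo_of_le (by positivity)] at h
  exact h

end Estimates
-- Weak compactness, Galerkin approximation and passage to the limit
section FixedPoint

variable {α : ℝ}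

/-- Weak convergence of a sequence in `L²(0, π/2)`. -/
def WeakTendsto (z : ℕ → L2) (ζ : L2) : Prop :=
  ∀ g : L2, Tendsto (fun n => inner ℝ g (z n)) atTop (𝓝 (inner ℝ g ζ))

/-- The set of nonnegative functions in the invariant ball. -/
def admissible : Set L2 := {ζ | 0 ≤ ζ ∧ ‖ζ‖ ≤ radius}

/-- The indicator function of a measurable set as an element of `L²(0, π/2)`. -/
def indicatorL2 {A : Set ℝ} (hA : MeasurableSet A) : L2 :=
  indicatorConstLp 2 hA (measure_ne_top _ _) (1 : ℝ)

theorem inner_indicatorL2 {A : Set ℝ} (hA : MeasurableSet A) (ζ : L2) :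
    inner ℝ (indicatorL2 hA) ζ = ∫ x in A, ζ x ∂quarter :=
  L2.inner_indicatorConstLp_one hA _ ζ

theorem indicatorL2_nonneg {A : Set ℝ} (hA : MeasurableSet A) : 0 ≤ indicatorL2 hA := by
  rw [← Lp.coeFn_nonneg]
  have h : indicatorL2 hA =ᵐ[quarter] A.indicator fun _ => (1 : ℝ) := indicatorConstLp_coeFn
  filter_upwards [h] with x hx
  rw [hx]
  exact indicator_nonneg (fun _ _ => zero_le_one) x

theorem smul_nonneg_L2 {c : ℝ} (hc : 0 ≤ c) {ζ : L2} (hζ : 0 ≤ ζ) : 0 ≤ c • ζ := by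
  rw [← Lp.coeFn_nonneg]
  filter_upwards [Lp.coeFn_smul c ζ, (Lp.coeFn_nonneg ζ).2 hζ] with x h1 h2
  rw [h1]
  exact mul_nonneg hc h2

/-- Sequential Banach–Alaoglu, transported from the dual by the Riesz isometry. -/
theorem exists_weakTendsto_subseq {z : ℕ → L2} {R : ℝ} (hz : ∀ n, ‖z n‖ ≤ R) :
    ∃ (ζ : L2) (φ : ℕ → ℕ), ‖ζ‖ ≤ R ∧ StrictMono φ ∧ WeakTendsto (fun n => z (φ n)) ζ := by
  have : Fact ((2 : ENNReal) ≠ ⊤) := ⟨ENNReal.ofNat_ne_top⟩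
  have hc := WeakDual.isSeqCompact_closedBall ℝ L2 (0 : StrongDual ℝ L2) R
  obtain ⟨a, ha, φ, hφ, hlim⟩ := hc
    (x := fun n => StrongDual.toWeakDual (InnerProductSpace.toDual ℝ L2 (z n))) (fun n => by
      simpa using hz n)
  refine ⟨(InnerProductSpace.toDual ℝ L2).symm (WeakDual.toStrongDual a), φ, by simpa using ha, hφ,
    fun g => ?_⟩
  have h := tendsto_iff_forall_eval_tendsto_topDualPairing.1 hlim g
  have h2 : inner ℝ g ((InnerProductSpace.toDual ℝ L2).symm (WeakDual.toStrongDual a)) =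
      topDualPairing ℝ L2 a g := by
    rw [real_inner_comm, InnerProductSpace.toDual_symm_apply]
    rfl
  rw [h2]
  refine h.congr fun n => ?_
  rw [real_inner_comm]
  rfl

theorem WeakTendsto.of_tendsto {z : ℕ → L2} {ζ : L2} (h : Tendsto z atTop (𝓝 ζ)) :
    WeakTendsto z ζ := fun _ => tendsto_const_nhds.inner h

theorem nonneg_of_weakTendsto {z : ℕ → L2} {ζ : L2} (h : WeakTendsto z ζ) (hz : ∀ n, 0 ≤ z n) :
    0 ≤ ζ := by
  rw [← Lp.coeFn_nonneg]
  refine ae_nonneg_of_forall_setIntegral_nonneg (integrable_coe_L2 ζ) fun A hA _ => ?_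
  rw [← inner_indicatorL2 hA]
  refine ge_of_tendsto' (h (indicatorL2 hA)) fun n => ?_
  rw [inner_indicatorL2 hA]
  exact integral_nonneg_of_ae (ae_restrict_of_ae ((Lp.coeFn_nonneg _).2 (hz n)))

theorem primitive_eq_inner (ζ : L2) {σ : ℝ} (hσ : σ ∈ Ioo 0 (π / 2)) :
    ∫ s in (0 : ℝ)..σ, ζ s = inner ℝ (indicatorL2 (measurableSet_Iic (a := σ))) ζ := by
  rw [inner_indicatorL2, intervalIntegral.integral_of_le hσ.1.le,
    Measure.restrict_restrict measurableSet_Iic]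
  congr 2
  ext x
  simp only [mem_Ioc, mem_inter_iff, mem_Iic, mem_Ioo]
  exact ⟨fun h => ⟨h.2, h.1, h.2.trans_lt hσ.2⟩, fun h => ⟨h.2.1, h.1⟩⟩

theorem tendsto_Phi_of_weakTendsto {z : ℕ → L2} {ζ : L2} (h : WeakTendsto z ζ) {σ : ℝ}
    (hσ : σ ∈ Ioo 0 (π / 2)) : Tendsto (fun n => Phi α (z n) σ) atTop (𝓝 (Phi α ζ σ)) := by
  have hH : Tendsto (fun n => H (z n) σ) atTop (𝓝 (H ζ σ)) := by
    simp_rw [H_eq_inner _ hσ]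
    exact (h _).const_mul _
  have hP : Tendsto (fun n => ∫ s in (0 : ℝ)..σ, z n s) atTop (𝓝 (∫ s in (0 : ℝ)..σ, ζ s)) := by
    simp_rw [primitive_eq_inner _ hσ]
    exact h _
  unfold Phi
  refine Tendsto.const_mul _ (Tendsto.div (Tendsto.mul_const _ ?_) ?_ (exp_pos _).ne')
  · exact (continuous_sin.tendsto _).comp ((hH.const_mul _).const_add _)
  · exact (continuous_exp.tendsto _).comp hP

/-- Pointwise convergence of Φ with dominated convergence. This supplies both the continuity needed
for Brouwer and the final limit, without strong L² convergence. -/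
theorem tendsto_setIntegral_Phi (hα : 0 < α) {z : ℕ → L2} {ζ : L2} (h : WeakTendsto z ζ)
    (hz : ∀ n, z n ∈ admissible) (A : Set ℝ) :
    Tendsto (fun n => ∫ σ in A, Phi α (z n) σ ∂quarter) atTop
      (𝓝 (∫ σ in A, Phi α ζ σ ∂quarter)) := by
  refine tendsto_integral_of_dominated_convergence
    (fun σ => (6 / (α * π) + radius / (α * π)) * σ ^ (-(1 / 2) : ℝ))
    (fun n => (aemeasurable_Phi α (z n)).aestronglyMeasurable.restrict)
    ((integrable_rpow_quarter.const_mul _).restrict) (fun n => ?_) ?_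
  · refine ae_restrict_of_ae ?_
    filter_upwards [ae_restrict_mem measurableSet_Ioo] with σ hσ
    rw [Real.norm_of_nonneg (Phi_nonneg hα (hz n).1 (hz n).2 hσ)]
    exact Phi_le_rpow hα (hz n).1 (hz n).2 hσ
  · refine ae_restrict_of_ae ?_
    filter_upwards [ae_restrict_mem measurableSet_Ioo] with σ hσ
    exact tendsto_Phi_of_weakTendsto h hσ

open Classical in
/-- The operator `Φ` on `L²(0, π/2)`, set to `0` where its values are not square-integrable. -/
def PhiL2 (α : ℝ) (ζ : L2) : L2 := if h : MemLp (Phi α ζ) 2 quarter then h.toLp _ else 0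

section Admissible

variable (hα : 2 / π * (1 + 1 / (3 * √π)) ≤ α) {ζ : L2} (hζ : ζ ∈ admissible)

include hα

theorem pos_of_le : 0 < α := lt_of_lt_of_le (by positivity) hα

include hζ

theorem coeFn_PhiL2 : PhiL2 α ζ =ᵐ[quarter] Phi α ζ := by
  rw [PhiL2, dif_pos (memLp_Phi hα hζ.1 hζ.2)]
  exact MemLp.coeFn_toLp _

theorem PhiL2_mem_admissible : PhiL2 α ζ ∈ admissible := by
  constructor
  · rw [← Lp.coeFn_nonneg]
    filter_upwards [coeFn_PhiL2 hα hζ, ae_restrict_mem measurableSet_Ioo] with σ h hσ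
    rw [h]
    exact Phi_nonneg (pos_of_le hα) hζ.1 hζ.2 hσ
  · rw [Lp.norm_def, eLpNorm_congr_ae (coeFn_PhiL2 hα hζ)]
    exact ENNReal.toReal_le_of_le_ofReal radius_pos.le (eLpNorm_Phi_le hα hζ.1 hζ.2)

theorem inner_indicatorL2_PhiL2 {A : Set ℝ} (hA : MeasurableSet A) :
    inner ℝ (indicatorL2 hA) (PhiL2 α ζ) = ∫ σ in A, Phi α ζ σ ∂quarter := by
  rw [inner_indicatorL2]
  exact integral_congr_ae (ae_restrict_of_ae (coeFn_PhiL2 hα hζ))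

end Admissible

/-- The finite-dimensional approximation: a nonnegative orthonormal family yields a fixed point
of the compression of `Φ` to its span. -/
theorem exists_galerkin_fixedPoint (hα : 2 / π * (1 + 1 / (3 * √π)) ≤ α) {N : ℕ} {c : ℝ}
    (hc : 0 ≤ c) {A : Fin N → Set ℝ} (hA : ∀ i, MeasurableSet (A i))
    (ho : Orthonormal ℝ fun i => c • indicatorL2 (hA i)) :
    ∃ z ∈ admissible, ∀ i, inner ℝ (c • indicatorL2 (hA i)) z =
      inner ℝ (c • indicatorL2 (hA i)) (PhiL2 α z) := by
  set u : Fin N → L2 := fun i => c • indicatorL2 (hA i) with hu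
  have hu0 : ∀ i, 0 ≤ u i := fun i => smul_nonneg_L2 hc (indicatorL2_nonneg (hA i))
  let S : EuclideanSpace ℝ (Fin N) → L2 := fun x => ∑ i, x i • u i
  have hSc : Continuous S := by fun_prop
  have hSn : ∀ x, ‖S x‖ = ‖x‖ := by
    intro x
    rw [← sq_eq_sq₀ (norm_nonneg _) (norm_nonneg _), ← real_inner_self_eq_norm_sq,
      EuclideanSpace.norm_sq_eq]
    simp only [S]
    rw [ho.inner_sum]
    simp [sq]
  -- Positive parts followed by radial shrinking map every coefficient vector into the invariant
  -- set, so the compressed map is defined and bounded on the whole space.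
  let p : EuclideanSpace ℝ (Fin N) → EuclideanSpace ℝ (Fin N) :=
    fun x => WithLp.toLp 2 fun i => max (x i) 0
  have hpc : Continuous p :=
    (PiLp.continuous_toLp 2 _).comp (continuous_pi fun i => by fun_prop)
  let ρ : EuclideanSpace ℝ (Fin N) → EuclideanSpace ℝ (Fin N) :=
    fun x => (radius / max radius ‖p x‖) • p x
  have hmax : ∀ x, 0 < max radius ‖p x‖ := fun x => lt_max_of_lt_left radius_pos
  have hρc : Continuous ρ := by
    refine Continuous.smul (Continuous.div continuous_const (by fun_prop) fun x => (hmax x).ne') hpc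
  have hρn : ∀ x, ‖ρ x‖ ≤ radius := by
    intro x
    simp only [ρ]
    rw [norm_smul, Real.norm_of_nonneg (div_nonneg radius_pos.le (hmax x).le),
      div_mul_eq_mul_div, div_le_iff₀ (hmax x)]
    have := radius_pos
    gcongr
    exact le_max_right _ _
  have hadm : ∀ x, S (ρ x) ∈ admissible := by
    intro x
    refine ⟨Finset.sum_nonneg fun i _ => smul_nonneg_L2 ?_ (hu0 i), (hSn _).trans_le (hρn x)⟩
    exact mul_nonneg (div_nonneg radius_pos.le (hmax x).le) (le_max_right _ _)
  have hin : ∀ ζ ∈ admissible, ∀ i, inner ℝ (u i) (PhiL2 α ζ) =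
      c * ∫ σ in A i, Phi α ζ σ ∂quarter := by
    intro ζ hζ i
    rw [hu, real_inner_smul_left, inner_indicatorL2_PhiL2 hα hζ]
  let F : EuclideanSpace ℝ (Fin N) → EuclideanSpace ℝ (Fin N) :=
    fun x => WithLp.toLp 2 fun i => inner ℝ (u i) (PhiL2 α (S (ρ x)))
  have hFc : Continuous F := by
    refine (PiLp.continuous_toLp 2 _).comp (continuous_pi fun i => ?_)
    refine continuous_iff_seqContinuous.2 fun x a hx => ?_
    have h1 : Tendsto (fun n => S (ρ (x n))) atTop (𝓝 (S (ρ a))) :=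
      ((hSc.comp hρc).tendsto a).comp hx
    have h2 := (tendsto_setIntegral_Phi (pos_of_le hα) (WeakTendsto.of_tendsto h1)
      (fun n => hadm (x n)) (A i)).const_mul c
    rw [hin _ (hadm a)]
    refine h2.congr fun n => ?_
    rw [Function.comp_apply, hin _ (hadm (x n))]
  have hFn : ∀ x, ‖F x‖ ≤ radius := by
    intro x
    have hm := (PhiL2_mem_admissible hα (hadm x)).2
    refine le_trans ?_ hm
    rw [← sq_le_sq₀ (norm_nonneg _) (norm_nonneg _), EuclideanSpace.norm_sq_eq]
    exact ho.sum_inner_products_le (s := Finset.univ) (PhiL2 α (S (ρ x)))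
  obtain ⟨x, hx⟩ := exists_fixedPoint_of_continuous_of_bounded hFc hFn
  have hxi : ∀ i, x i = inner ℝ (u i) (PhiL2 α (S (ρ x))) := by
    intro i
    conv_lhs => rw [← hx]
  -- The fixed point has non-negative coordinates, and norm at most the radius by Bessel, so the
  -- truncation leaves it unchanged.
  have hx0 : ∀ i, 0 ≤ x i := by
    intro i
    rw [hxi, hin _ (hadm x)]
    refine mul_nonneg hc (integral_nonneg_of_ae (ae_restrict_of_ae ?_))
    filter_upwards [ae_restrict_mem measurableSet_Ioo] with σ hσ
    exact Phi_nonneg (pos_of_le hα) (hadm x).1 (hadm x).2 hσ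
  have hpx : p x = x := by
    ext i
    exact max_eq_left (hx0 i)
  have hρx : ρ x = x := by
    have hle : ‖x‖ ≤ radius := by
      rw [← hx]
      exact hFn x
    simp only [ρ]
    rw [hpx, max_eq_left hle, div_self radius_pos.ne', one_smul]
  refine ⟨S x, hρx ▸ hadm x, fun i => ?_⟩
  have h1 : inner ℝ (u i) (S x) = x i := ho.inner_right_fintype _ i
  rw [h1, hxi, hρx]

theorem quarter_real_Ioc {a b : ℝ} (ha : 0 ≤ a) (hab : a ≤ b) (hb : b ≤ π / 2) :
    quarter.real (Ioc a b) = b - a := by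
  have h : Ioc a b =ᵐ[quarter] Ioo a b := by
    exact ae_restrict_of_ae Ioo_ae_eq_Ioc.symm
  rw [measureReal_congr h, measureReal_restrict_apply measurableSet_Ioo,
    inter_eq_left.2 (Ioo_subset_Ioo ha hb), Real.volume_real_Ioo_of_le hab]

/-- Normalised indicators of the grid cells are orthonormal and non-negative. The Galerkin equations
match integrals cell by cell, and adding cells matches primitives at grid points. -/
theorem exists_galerkin_uniform_grid (hα : 2 / π * (1 + 1 / (3 * √π)) ≤ α) {N : ℕ} (hN : 0 < N) :
    ∃ z ∈ admissible, ∀ j : ℕ, j ≤ N →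
      ∫ σ in Iic (j * (π / 2 / N)), z σ ∂quarter =
        ∫ σ in Iic (j * (π / 2 / N)), Phi α z σ ∂quarter := by
  have hN' : (0 : ℝ) < N := by exact_mod_cast hN
  set h : ℝ := π / 2 / N with hh
  have hh0 : 0 < h := by positivity
  have hNh : N * h = π / 2 := by rw [hh]; field_simp
  let A : Fin N → Set ℝ := fun i => Ioc (i * h) ((i + 1 : ℕ) * h)
  have hA : ∀ i, MeasurableSet (A i) := fun i => measurableSet_Ioc
  have hbd : ∀ i : Fin N, ((i + 1 : ℕ) : ℝ) * h ≤ π / 2 := by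
    intro i
    rw [← hNh]
    gcongr
    exact i.2
  have hdisj : ∀ i j : Fin N, i < j → A i ∩ A j = ∅ := by
    intro i j hij
    ext x
    simp only [A, mem_inter_iff, mem_Ioc, mem_empty_iff_false, iff_false]
    rintro ⟨⟨_, h1⟩, h2, _⟩
    have : ((i + 1 : ℕ) : ℝ) * h ≤ j * h := by
      gcongr
      exact hij
    linarith
  have hsq : (√h)⁻¹ * ((√h)⁻¹ * h) = 1 := by
    have := sqrt_pos.2 hh0
    nth_rewrite 3 [← mul_self_sqrt hh0.le]
    field_simp
  have ho : Orthonormal ℝ fun i => (√h)⁻¹ • indicatorL2 (hA i) := by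
    classical
    rw [orthonormal_iff_ite]
    intro i j
    rw [real_inner_smul_left, real_inner_smul_right, indicatorL2, indicatorL2,
      L2.real_inner_indicatorConstLp_one_indicatorConstLp_one (hA i) (hA j)]
    split_ifs with hij
    · subst hij
      rw [inter_self, quarter_real_Ioc (by positivity) (by gcongr; exact Nat.le_succ _) (hbd i)]
      rw [← sub_mul]
      push_cast
      rw [add_sub_cancel_left, one_mul, hsq]
    · rcases lt_or_gt_of_ne hij with h1 | h1
      · simp [hdisj i j h1]
      · simp [inter_comm (A i), hdisj j i h1]
  obtain ⟨z, hz, hzi⟩ := exists_galerkin_fixedPoint hα (by positivity) hA ho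
  have hint : ∀ i, ∫ σ in A i, z σ ∂quarter = ∫ σ in A i, Phi α z σ ∂quarter := by
    intro i
    have h1 := hzi i
    rw [real_inner_smul_left, real_inner_smul_left, inner_indicatorL2,
      inner_indicatorL2_PhiL2 hα hz] at h1
    exact mul_left_cancel₀ (inv_ne_zero (sqrt_pos.2 hh0).ne') h1
  have hPi : Integrable (Phi α z) quarter :=
    (memLp_Phi hα hz.1 hz.2).integrable one_le_two
  have hzI := integrable_coe_L2 z
  refine ⟨z, hz, fun j => ?_⟩
  induction j with
  | zero =>
    intro _
    have h0 : quarter.restrict (Iic ((0 : ℕ) * h)) = 0 := by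
      rw [Measure.restrict_restrict measurableSet_Iic]
      have : Iic (((0 : ℕ) : ℝ) * h) ∩ Ioo 0 (π / 2) = ∅ := by
        ext x
        simp only [mem_inter_iff, mem_Iic, mem_Ioo, mem_empty_iff_false, iff_false]
        rintro ⟨h1, h2, _⟩
        simp at h1
        linarith
      rw [this, Measure.restrict_empty]
    rw [h0, integral_zero_measure, integral_zero_measure]
  | succ j ih =>
    intro hj
    have hle : (j : ℝ) * h ≤ (j + 1 : ℕ) * h := by gcongr; exact Nat.le_succ _
    have hd : Disjoint (Iic ((j : ℝ) * h)) (Ioc ((j : ℝ) * h) ((j + 1 : ℕ) * h)) :=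
      Iic_disjoint_Ioc le_rfl
    rw [← Iic_union_Ioc_eq_Iic hle, setIntegral_union hd measurableSet_Ioc hzI.integrableOn
      hzI.integrableOn, setIntegral_union hd measurableSet_Ioc hPi.integrableOn hPi.integrableOn,
      ih (by omega)]
    congr 1
    exact hint ⟨j, by omega⟩

/-- A π-λ argument from half-lines; the total integral handles complements. -/
theorem ae_eq_zero_of_forall_setIntegral_Iic {μ : Measure ℝ} {f : ℝ → ℝ} (hf : Integrable f μ)
    (huniv : ∫ x, f x ∂μ = 0) (hIic : ∀ b, ∫ x in Iic b, f x ∂μ = 0) : f =ᵐ[μ] 0 := by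
  refine Integrable.ae_eq_zero_of_forall_setIntegral_eq_zero hf fun A hA hμA => ?_
  clear hμA
  induction A, hA using MeasurableSpace.induction_on_inter (borel_eq_generateFrom_Iic ℝ)
    isPiSystem_Iic with
  | empty => simp
  | basic t ht =>
    obtain ⟨b, rfl⟩ := ht
    exact hIic b
  | compl t ht ih =>
    have := integral_add_compl ht hf
    rwa [ih, zero_add, huniv] at this
  | iUnion t hd ht ih =>
    rw [integral_iUnion ht hd hf.integrableOn]
    simp [ih]

theorem norm_indicatorL2 {A : Set ℝ} (hA : MeasurableSet A) :
    ‖indicatorL2 hA‖ = √(quarter.real A) := by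
  rw [indicatorL2, norm_indicatorConstLp two_ne_zero ENNReal.ofNat_ne_top, sqrt_eq_rpow]
  simp

theorem abs_setIntegral_Ioc_le {z w : L2} {R : ℝ} (hz : ‖z‖ ≤ R) (hw : ‖w‖ ≤ R) {a b : ℝ}
    (ha : 0 ≤ a) (hab : a ≤ b) (hb : b ≤ π / 2) :
    |∫ x in Ioc a b, z x ∂quarter - ∫ x in Ioc a b, w x ∂quarter| ≤ √(b - a) * (R + R) := by
  rw [← inner_indicatorL2 measurableSet_Ioc, ← inner_indicatorL2 measurableSet_Ioc, ← inner_sub_right]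
  refine (abs_real_inner_le_norm _ _).trans ?_
  rw [norm_indicatorL2, quarter_real_Ioc ha hab hb]
  gcongr
  exact (norm_sub_le _ _).trans (add_le_add hz hw)

theorem exists_admissible_ae_eq_Phi (hα : 2 / π * (1 + 1 / (3 * √π)) ≤ α) :
    ∃ ζ ∈ admissible, ζ =ᵐ[quarter] Phi α ζ := by
  choose z hz hgrid using fun n : ℕ => exists_galerkin_uniform_grid hα (Nat.succ_pos n)
  obtain ⟨ζ, φ, hn, hφ, hlim⟩ := exists_weakTendsto_subseq fun n => (hz n).2
  have hadm : ζ ∈ admissible := ⟨nonneg_of_weakTendsto hlim fun n => (hz _).1, hn⟩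
  refine ⟨ζ, hadm, ?_⟩
  have hPi : ∀ w ∈ admissible, Integrable (Phi α w) quarter := fun w hw =>
    (memLp_Phi hα hw.1 hw.2).integrable one_le_two
  have herr : ∀ b ∈ Icc 0 (π / 2), ∀ n : ℕ,
      |∫ σ in Iic b, z n σ ∂quarter - ∫ σ in Iic b, Phi α (z n) σ ∂quarter| ≤
        √(π / 2 * (1 / ((n : ℝ) + 1))) * (radius + radius) := by
    intro b hb n
    set h : ℝ := π / 2 / (n.succ : ℕ) with hh
    have hh0 : 0 < h := by positivity
    -- The last grid point not beyond b: primitives agree there, and Cauchy–Schwarz on the rest of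
    -- the cell costs at most √h · 2R.
    set j := ⌊b / h⌋₊ with hj
    have hj1 : j * h ≤ b := by
      rw [← le_div_iff₀ hh0]
      exact Nat.floor_le (div_nonneg hb.1 hh0.le)
    have hj2 : b < (j + 1) * h := by
      rw [← div_lt_iff₀ hh0]
      exact Nat.lt_floor_add_one _
    have hjN : j ≤ n.succ := by
      have hNh : (n.succ : ℕ) * h = π / 2 := by rw [hh]; field_simp
      refine Nat.floor_le_of_le ?_
      rw [div_le_iff₀ hh0, hNh]
      exact hb.2
    have hg := hgrid n j hjN
    have hd : Disjoint (Iic (j * h)) (Ioc (j * h) b) := Iic_disjoint_Ioc le_rfl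
    have hP := hPi _ (hz n)
    have hZ := integrable_coe_L2 (z n)
    rw [← Iic_union_Ioc_eq_Iic hj1, setIntegral_union hd measurableSet_Ioc hZ.integrableOn
      hZ.integrableOn, setIntegral_union hd measurableSet_Ioc hP.integrableOn hP.integrableOn,
      hg, add_sub_add_left_eq_sub, ← inner_indicatorL2_PhiL2 hα (hz n) measurableSet_Ioc, inner_indicatorL2]
    refine (abs_setIntegral_Ioc_le (hz n).2 (PhiL2_mem_admissible hα (hz n)).2 (by positivity) hj1
      hb.2).trans ?_
    have := radius_pos
    gcongr
    have h1 : π / 2 * (1 / ((n : ℝ) + 1)) = h := by rw [hh]; push_cast; ring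
    rw [h1]
    linarith
  have hIcc : ∀ b ∈ Icc 0 (π / 2), ∫ σ in Iic b, (ζ σ - Phi α ζ σ) ∂quarter = 0 := by
    intro b hb
    rw [integral_sub (integrable_coe_L2 ζ).integrableOn (hPi ζ hadm).integrableOn]
    have h1 : Tendsto (fun n => ∫ σ in Iic b, z (φ n) σ ∂quarter -
        ∫ σ in Iic b, Phi α (z (φ n)) σ ∂quarter) atTop
        (𝓝 (∫ σ in Iic b, ζ σ ∂quarter - ∫ σ in Iic b, Phi α ζ σ ∂quarter)) := by
      refine Tendsto.sub ?_ (tendsto_setIntegral_Phi (pos_of_le hα) hlim (fun n => hz _) _)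
      simp_rw [← inner_indicatorL2 measurableSet_Iic]
      exact hlim _
    have h2 : Tendsto (fun n => ∫ σ in Iic b, z (φ n) σ ∂quarter -
        ∫ σ in Iic b, Phi α (z (φ n)) σ ∂quarter) atTop (𝓝 0) := by
      have h3 : Tendsto (fun n : ℕ => √(π / 2 * (1 / ((n : ℝ) + 1))) * (radius + radius)) atTop
          (𝓝 0) := by
        have h4 := ((tendsto_one_div_add_atTop_nhds_zero_nat (𝕜 := ℝ)).const_mul (π / 2)).sqrt
        simpa using h4.mul_const (radius + radius)
      exact squeeze_zero_norm (fun n => herr b hb (φ n)) (h3.comp hφ.tendsto_atTop)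
    exact tendsto_nhds_unique h1 h2
  have hpi : (0 : ℝ) ≤ π / 2 := by positivity
  have hfull : ∀ b, π / 2 ≤ b → quarter.restrict (Iic b) = quarter := fun b hb => by
    rw [Measure.restrict_restrict measurableSet_Iic,
      inter_eq_right.2 fun x hx => hx.2.le.trans hb]
  have hsub : Integrable (fun σ => ζ σ - Phi α ζ σ) quarter :=
    (integrable_coe_L2 ζ).sub (hPi ζ hadm)
  have htot : ∫ σ, (ζ σ - Phi α ζ σ) ∂quarter = 0 := by
    rw [← hfull (π / 2) le_rfl]
    exact hIcc _ (right_mem_Icc.2 hpi)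
  have hzero := ae_eq_zero_of_forall_setIntegral_Iic hsub htot fun b => by
    rcases le_total b 0 with hb | hb
    · have : quarter.restrict (Iic b) = 0 := by
        rw [Measure.restrict_restrict measurableSet_Iic, Measure.restrict_eq_zero]
        have : Iic b ∩ Ioo 0 (π / 2) = ∅ := by
          ext x
          simp only [mem_inter_iff, mem_Iic, mem_Ioo, mem_empty_iff_false, iff_false]
          rintro ⟨h1, h2, _⟩
          linarith
        rw [this, measure_empty]
      rw [this, integral_zero_measure]
    · rcases le_total b (π / 2) with hb' | hb'
      · exact hIcc b ⟨hb, hb'⟩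
      · rw [hfull b hb']
        exact htot
  filter_upwards [hzero] with σ hσ
  exact sub_eq_zero.1 hσ

end FixedPoint
end Nekrasov
end

theorem theorem3p7 (α : ℝ)
    (hα : 2 / Real.pi * (1 + 1 / (3 * Real.sqrt Real.pi)) ≤ α) :
    ∃ ζ : Nekrasov.L2,
      0 ≤ ζ ∧
      (∀ᵐ σ ∂(volume.restrict (Ioo (0 : ℝ) (Real.pi / 2))), ζ σ = Nekrasov.Phi α ζ σ) ∧
      (∀ᵐ σ ∂(volume.restrict (Ioo (0 : ℝ) (Real.pi / 2))),
        0 ≤ σ + 1 / 3 * Nekrasov.H ζ σ ∧ σ + 1 / 3 * Nekrasov.H ζ σ ≤ Real.pi) ∧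
      ‖ζ‖ ≤ 9 * Real.sqrt Real.pi / 2 := by
  obtain ⟨ζ, hζ, heq⟩ := Nekrasov.exists_admissible_ae_eq_Phi hα
  refine ⟨ζ, hζ.1, heq, ?_, hζ.2⟩
  filter_upwards [ae_restrict_mem measurableSet_Ioo] with σ hσ
  exact Nekrasov.angle_mem_Icc hζ.1 hζ.2 hσ
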